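/- Let $n\ge 3$, $\alpha\in\mathbb R\setminus\{0\}$, and let $\beta$ be a real function such that $s\mapsto \beta(s^2)s$ is continuously differentiable on $\mathbb R$ and, for some constants $C$ and $p\in\bigl(1,\,1+\frac{4}{n-2}\bigr)$, $$|\beta(s^2)|\le C|s|^{p-1}\qquad\text{for all } s\in\mathbb R .$$ Put $G(s)=\int_0^s\bigl(\beta(\tau^2)\tau-\frac{\alpha^2}{2}\tau\bigr)\,d\tau$, and suppose that $G(s_0)>0$ for some $s_0$ and that $$\beta(s^2)s^2\ \ge\ 2\int_0^s\beta(\tau^2)\tau\,d\tau\qquad\text{for all } s\ge 0 .$$ Let $\phi$ be a ground state of $$-\tfrac12\Delta\phi-\beta(\phi^2)\phi+\tfrac{\alpha^2}{2}\phi=0\quad\text{on }\mathbb R^n$$ constructed from the variational problem, that is, $\phi(x)=w(\lambda^{-1/2}x)$, where $w$ is a positive, radial $C^2$ function that minimizes $J[u]=\int_{\mathbb R^n}|\nabla u|^2$ among all real $u\in H^1(\mathbb R^n)$ with $\int_{\mathbb R^n}G(u)=1$, and $\lambda$ is the Lagrange multiplier in the Euler-Lagrange equation $-\frac12\Delta w-\lambda\bigl(\beta(w^2)w-\frac{\alpha^2}{2}w\bigr)=0$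 (under the above assumptions $\lambda>0$). Then the operator $$L_+=-\tfrac12\Delta-\beta(\phi^2)-2\beta'(\phi^2)\phi^2+\tfrac{\alpha^2}{2}$$ on $L^2(\mathbb R^n;\mathbb C)$ with domain $H^2(\mathbb R^n)$ has exactly one negative eigenvalue, and this eigenvalue is simple (its eigenspace is one-dimensional). -/

import Mathlib

open MeasureTheory TemperedDistribution
open scoped ContDiff ENNReal SchwartzMap Laplacian

noncomputable section

namespace NLS

/-- The space `ℝⁿ` with its Euclidean norm. -/
abbrev Rn (n : ℕ) := EuclideanSpace ℝ (Fin n)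

/-! ### The constrained variational problem -/

/-- `G(s) = ∫₀ˢ (β(τ²) τ - (α²/2) τ) dτ`. -/
def G (β : ℝ → ℝ) (α s : ℝ) : ℝ := ∫ τ in (0 : ℝ)..s, (β (τ ^ 2) * τ - α ^ 2 / 2 * τ)

/-- `g` is the weak (distributional) gradient of the real function `u` on `ℝⁿ`. -/
def HasWeakGradient {n : ℕ} (u : Rn n → ℝ) (g : Rn n → Rn n) : Prop :=
  LocallyIntegrable u ∧ LocallyIntegrable g ∧
    ∀ ψ : Rn n → ℝ, ContDiff ℝ ∞ ψ → HasCompactSupport ψ → ∀ v : Rn n,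
      ∫ x, u x * fderiv ℝ ψ x v = - ∫ x, inner ℝ (g x) v * ψ x

/-- `u ∈ H¹(ℝⁿ)` with weak gradient `g`, and `u` satisfies the constraint
`W[u] = ∫ G(u) = 1`. -/
structure IsAdmissible {n : ℕ} (β : ℝ → ℝ) (α : ℝ) (u : Rn n → ℝ) (g : Rn n → Rn n) : Prop where
  memLp : MemLp u 2
  memLp_grad : MemLp g 2
  weakGradient : HasWeakGradient u g
  integrable : Integrable (fun x => G β α (u x))
  constraint : ∫ x, G β α (u x) = 1

/-- `w` minimizes `J[u] = ∫ |∇u|²` among all `u ∈ H¹(ℝⁿ)` with `W[u] = 1`. -/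
def IsConstrainedMinimizer {n : ℕ} (β : ℝ → ℝ) (α : ℝ) (w : Rn n → ℝ) : Prop :=
  ∃ g : Rn n → Rn n, IsAdmissible β α w g ∧
    ∀ (u : Rn n → ℝ) (h : Rn n → Rn n), IsAdmissible β α u h →
      ∫ x, ‖g x‖ ^ 2 ≤ ∫ x, ‖h x‖ ^ 2

/-- `φ` is a ground state of `-½ Δφ - β(φ²) φ + (α²/2) φ = 0` constructed from the variational
problem: there is a positive radial `C²` minimizer `w` which satisfies the Euler-Lagrange equation
`-½ Δw - lam (β(w²) w - (α²/2) w) = 0` with Lagrange multiplier `lam`, and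
`φ(x) = w(lam ^ (-1/2) x)`. The sign of the multiplier is not prescribed. -/
def IsVariationalGroundState {n : ℕ} (β : ℝ → ℝ) (α : ℝ) (φ : Rn n → ℝ) : Prop :=
  ∃ (w : Rn n → ℝ) (lam : ℝ),
    IsConstrainedMinimizer β α w ∧
    ContDiff ℝ 2 w ∧
    (∀ x, 0 < w x) ∧
    (∀ x y, ‖x‖ = ‖y‖ → w x = w y) ∧
    (∀ x, -(1 / 2) * Δ w x - lam * (β (w x ^ 2) * w x - α ^ 2 / 2 * w x) = 0) ∧
    ∀ x, φ x = w (lam ^ (-(1 / 2) : ℝ) • x)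

/-! ### The linearized operator as an unbounded operator on `L²(ℝⁿ; ℂ)` -/

/-- The complex Hilbert space `L²(ℝⁿ)`. -/
abbrev L2 (n : ℕ) := Lp ℂ 2 (volume : Measure (Rn n))

/-- The Sobolev space `H²(ℝⁿ)`, as a subspace of `L²(ℝⁿ)`. -/
def H2 (n : ℕ) : Submodule ℂ (L2 n) where
  carrier := {u | MemSobolev 2 2 (u : 𝓢'(Rn n, ℂ))}
  add_mem' {u v} hu hv := by
    have h := MemSobolev.add hu hv
    simp only [← Lp.toTemperedDistributionCLM_apply, ← map_add] at h
    exact h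
  zero_mem' := by
    have h := memSobolev_fun_zero (Rn n) ℂ 2 (p := 2)
    rw [← map_zero (Lp.toTemperedDistributionCLM ℂ (volume : Measure (Rn n)) 2)] at h
    exact h
  smul_mem' c u hu := by
    have h := MemSobolev.smul c hu
    simp only [← Lp.toTemperedDistributionCLM_apply, ← map_smul] at h
    exact h

lemma toTemperedDistribution_injective {n : ℕ} {f g : L2 n}
    (h : (f : 𝓢'(Rn n, ℂ)) = (g : 𝓢'(Rn n, ℂ))) : f = g := by
  have hk := Lp.ker_toTemperedDistributionCLM_eq_bot (F := ℂ) (μ := (volume : Measure (Rn n)))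
    (p := 2)
  exact LinearMap.ker_eq_bot.mp hk h

lemma exists_laplacian {n : ℕ} (u : H2 n) :
    ∃ f : L2 n, Δ ((u : L2 n) : 𝓢'(Rn n, ℂ)) = (f : 𝓢'(Rn n, ℂ)) := by
  have h := MemSobolev.laplacian u.2
  rw [sub_self] at h
  exact memSobolev_zero_iff.mp h

lemma laplacian_add' {n : ℕ} (f g : 𝓢'(Rn n, ℂ)) : Δ (f + g) = Δ f + Δ g := by
  simp only [← laplacianCLM_apply, map_add]

lemma laplacian_smul' {n : ℕ} (c : ℂ) (f : 𝓢'(Rn n, ℂ)) : Δ (c • f) = c • Δ f := by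
  simp only [← laplacianCLM_apply, map_smul]

/-- The distributional Laplacian `Δ : H²(ℝⁿ) → L²(ℝⁿ)`. -/
def laplacianH2 (n : ℕ) : H2 n →ₗ[ℂ] L2 n where
  toFun u := (exists_laplacian u).choose
  map_add' u v := by
    apply toTemperedDistribution_injective
    rw [← (exists_laplacian (u + v)).choose_spec]
    have hu := (exists_laplacian u).choose_spec
    have hv := (exists_laplacian v).choose_spec
    simp only [← Lp.toTemperedDistributionCLM_apply, Submodule.coe_add, map_add] at hu hv ⊢
    rw [← hu, ← hv, laplacian_add']
  map_smul' c u := by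
    apply toTemperedDistribution_injective
    rw [← (exists_laplacian (c • u)).choose_spec]
    have hu := (exists_laplacian u).choose_spec
    simp only [← Lp.toTemperedDistributionCLM_apply, Submodule.coe_smul, map_smul,
      RingHom.id_apply] at hu ⊢
    rw [← hu, laplacian_smul']

lemma laplacianH2_spec {n : ℕ} (u : H2 n) :
    Δ ((u : L2 n) : 𝓢'(Rn n, ℂ)) = (laplacianH2 n u : 𝓢'(Rn n, ℂ)) :=
  (exists_laplacian u).choose_spec

/-- The natural domain of multiplication by the real function `V` in `L²(ℝⁿ)`. -/
def mulDomain {n : ℕ} (V : Rn n → ℝ) : Submodule ℂ (L2 n) where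
  carrier := {u | MemLp (fun x => (V x : ℂ) * u x) 2}
  add_mem' {u v} hu hv := by
    refine (MemLp.add hu hv).ae_eq ?_
    filter_upwards [Lp.coeFn_add u v] with x hx
    simp only [hx, Pi.add_apply, mul_add]
  zero_mem' := by
    refine (MemLp.zero (ε := ℂ) (p := 2) (μ := (volume : Measure (Rn n)))).ae_eq ?_
    filter_upwards [Lp.coeFn_zero ℂ 2 (volume : Measure (Rn n))] with x _
    simp
  smul_mem' c u hu := by
    refine (MemLp.const_smul hu c).ae_eq ?_
    filter_upwards [Lp.coeFn_smul c u] with x hx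
    simp only [Pi.smul_apply, smul_eq_mul, hx]
    ring

lemma memLp_mul {n : ℕ} {V : Rn n → ℝ} (u : mulDomain V) :
    MemLp (fun x => (V x : ℂ) * (u : L2 n) x) 2 := u.2

/-- Multiplication by the real function `V`, on its natural domain. -/
def mulOp {n : ℕ} (V : Rn n → ℝ) : mulDomain V →ₗ[ℂ] L2 n where
  toFun u := (memLp_mul u).toLp
  map_add' u v := by
    apply Lp.ext
    filter_upwards [Lp.coeFn_add (u : L2 n) (v : L2 n), (memLp_mul (u + v)).coeFn_toLp,
      (memLp_mul u).coeFn_toLp, (memLp_mul v).coeFn_toLp,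
      Lp.coeFn_add (memLp_mul u).toLp (memLp_mul v).toLp] with x h1 h2 h3 h4 h5
    rw [h5, h2, Pi.add_apply, h3, h4, Submodule.coe_add, h1, Pi.add_apply, mul_add]
  map_smul' c u := by
    apply Lp.ext
    filter_upwards [Lp.coeFn_smul c (u : L2 n), (memLp_mul (c • u)).coeFn_toLp,
      (memLp_mul u).coeFn_toLp, Lp.coeFn_smul c (memLp_mul u).toLp] with x h1 h2 h3 h4
    rw [RingHom.id_apply, h4, h2, Pi.smul_apply, h3, Submodule.coe_smul, h1, Pi.smul_apply,
      smul_eq_mul, smul_eq_mul]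
    ring

/-- The Schrödinger operator `-½ Δ + c - V` on `L²(ℝⁿ)`, with domain
`{u ∈ H²(ℝⁿ) | V u ∈ L²(ℝⁿ)}`; this domain is `H²(ℝⁿ)` when `V` is measurable and bounded. -/
def schrodinger {n : ℕ} (c : ℝ) (V : Rn n → ℝ) : L2 n →ₗ.[ℂ] L2 n where
  domain := H2 n ⊓ mulDomain V
  toFun :=
    (-(1 / 2) : ℂ) • laplacianH2 n ∘ₗ Submodule.inclusion inf_le_left
      + (c : ℂ) • (H2 n ⊓ mulDomain V).subtype
      - mulOp V ∘ₗ Submodule.inclusion inf_le_right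

/-- The operator `L₊ = -½ Δ - β(φ²) - 2 β'(φ²) φ² + α²/2`. -/
def Lplus {n : ℕ} (β : ℝ → ℝ) (α : ℝ) (φ : Rn n → ℝ) : L2 n →ₗ.[ℂ] L2 n :=
  schrodinger (α ^ 2 / 2) (fun x => β (φ x ^ 2) + 2 * deriv β (φ x ^ 2) * φ x ^ 2)

/-- The eigenspace `{u ∈ Dom(T) | T u = μ u}` of an unbounded operator `T`. -/
def eigenspace {H : Type*} [AddCommGroup H] [Module ℂ H] (T : H →ₗ.[ℂ] H) (μ : ℂ) :
    Submodule ℂ T.domain :=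
  LinearMap.ker (T.toFun - μ • T.domain.subtype)

end NLS

end

noncomputable section

open MeasureTheory TemperedDistribution Filter Topology
open scoped ContDiff ENNReal SchwartzMap Laplacian Gradient Real LineDeriv ComplexConjugate

namespace NLS

/-! Write `f = G'`, `W[u] = ∫ G(u)` and `θ = (n-2)/n`. Dilations multiply `∫|∇u|²` by `t^(2-n)` and
`W` by `t^(-n)`, so the constrained minimizer, and with it every dilate such as `φ`, minimizes the
scale-invariant quotient `∫|∇u|² / W[u]^θ` with no constraint except `W[u] > 0`. After the dilation
the equation has multiplier one, and the second variation of the quotient reads `⟨ψ, L₊ψ⟩ ≥ -κ (∫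
f(φ) ψ)²` with `κ = (1-θ)/W[φ] ≥ 0` (`IsQuotientMin.variation`). Thus the form of `L₊` is
nonnegative on the hyperplane orthogonal to `f(φ)`, which leaves room for at most one negative
eigenvalue, and for a simple one only: a two-dimensional span of negative eigenvectors would meet
the hyperplane (`eigenvalue_unique`).

The form does become negative. Differentiating the equation along dilations gives, formally,
`L₊(x·∇φ) = 2f(φ)`, whence `⟨x·∇φ, L₊(x·∇φ)⟩ = 2∫ x·∇(G(φ)) = -2n W[φ] < 0`. Since `φ` is only `C²`
and `x·∇φ` need not be square integrable, `dilation_nonneg` and `exists_negative_direction` work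
with difference quotients and cutoffs.

The negative infimum of the form on the unit sphere of `L²` is attained, with no compactness
argument: along a subsequence of a minimizing sequence the pairing with `f(φ)` converges, and on the
hyperplane the form minus its infimum controls the `L²` norm, so the subsequence is Cauchy
(`exists_cauchy_minimizing_sequence`). The limit is a weak eigenfunction, and it lies in `H²`
because it and its Laplacian are in `L²`. Density of Schwartz functions in the graph norm carries
the lower bound from real `C¹` functions to the complex operator on `H²`. -/

/-! ### Abstract minimization of a form that is nonnegative up to rank one -/

/-- A symmetric form `q` that takes a negative value and is bounded below by a negative multiple
of the square of a `ν`-bounded functional has a negative infimum on the `ν`-unit sphere, and a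
`ν`-Cauchy minimizing sequence. -/
theorem exists_cauchy_minimizing_sequence {V : Type*} [AddCommGroup V] [Module ℝ V]
    (q ν : LinearMap.BilinForm ℝ V) (ℓ : V →ₗ[ℝ] ℝ) (hq : q.IsSymm) (hν : ν.IsSymm)
    (hν0 : ∀ x, 0 ≤ ν x x) {κ M : ℝ} (hκ : 0 ≤ κ) (hqℓ : ∀ x, -κ * ℓ x ^ 2 ≤ q x x)
    (hℓ : ∀ x, ℓ x ^ 2 ≤ M * ν x x) {x₀ : V} (hx₀ : q x₀ x₀ < 0) :
    ∃ E < 0, ∃ u : ℕ → V, (∀ k, ν (u k) (u k) = 1) ∧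
      (∀ ε > 0, ∃ N, ∀ k ≥ N, ∀ l ≥ N, ν (u k - u l) (u k - u l) < ε) ∧
      ∀ y, Tendsto (fun k => q (u k) y - E * ν (u k) y) atTop (𝓝 0) := by
  have hqν : ∀ x, -(κ * M) * ν x x ≤ q x x := fun x => by
    nlinarith [hqℓ x, mul_le_mul_of_nonneg_left (hℓ x) hκ]
  have hνpos : ∀ x, q x x < 0 → 0 < ν x x := fun x hx => by
    rcases (hν0 x).lt_or_eq with h | h
    · exact h
    · have := hqν x; rw [← h] at this; linarith
  set S : Set ℝ := {r | ∃ x, ν x x = 1 ∧ q x x = r} with hS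
  set E := sInf S with hE
  have hbdd : BddBelow S := ⟨-(κ * M), by
    rintro r ⟨x, hx, rfl⟩
    simpa [hx] using hqν x⟩
  have hscale : ∀ x, 0 < ν x x → q x x / ν x x ∈ S := fun x hx => by
    refine ⟨(√(ν x x))⁻¹ • x, ?_, ?_⟩ <;>
    · simp only [map_smul, LinearMap.smul_apply, smul_eq_mul]
      rw [← mul_assoc, ← mul_inv, Real.mul_self_sqrt hx.le]
      field_simp
  have hne : S.Nonempty := ⟨_, hscale x₀ (hνpos x₀ hx₀)⟩
  have hE0 : E < 0 :=
    (csInf_le hbdd (hscale x₀ (hνpos x₀ hx₀))).trans_lt (div_neg_of_neg_of_pos hx₀ (hνpos x₀ hx₀))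
  -- The shifted form is nonnegative because `E` is the infimum of the Rayleigh quotient, so it
  -- obeys Cauchy–Schwarz; it tends to zero along minimizing sequences.
  set p : LinearMap.BilinForm ℝ V := q - E • ν with hp
  have hpapp : ∀ x y, p x y = q x y - E * ν x y := fun x y => by simp [hp]
  have hp0 : ∀ x, 0 ≤ p x x := fun x => by
    rw [hpapp]
    by_cases h : q x x < 0
    · have h1 := csInf_le hbdd (hscale x (hνpos x h))
      rw [← hE, le_div_iff₀ (hνpos x h)] at h1
      linarith
    · nlinarith [hν0 x]
  have hps : ∀ x y, p x y = p y x := fun x y => by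
    rw [hpapp, hpapp]
    have h1 := hq.eq x y
    have h2 := hν.eq x y
    rw [h1, h2]
  have hCS : ∀ x y, p x y ^ 2 ≤ p x x * p y y := fun x y =>
    LinearMap.BilinForm.apply_sq_le_of_symm p hp0 ⟨fun a b => by simpa using hps a b⟩ x y
  have hadd : ∀ (b : LinearMap.BilinForm ℝ V), (∀ x, 0 ≤ b x x) → ∀ x y,
      b (x + y) (x + y) ≤ 2 * b x x + 2 * b y y := fun b hb x y => by
    have := hb (x - y)
    simp only [map_add, map_sub, LinearMap.add_apply, LinearMap.sub_apply] at this ⊢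
    linarith
  have hsub : ∀ (b : LinearMap.BilinForm ℝ V), (∀ x, 0 ≤ b x x) → ∀ x y,
      b (x - y) (x - y) ≤ 2 * b x x + 2 * b y y := fun b hb x y => by
    have := hb (x + y)
    simp only [map_add, map_sub, LinearMap.add_apply, LinearMap.sub_apply] at this ⊢
    linarith
  have hseq : ∀ k : ℕ, ∃ u, ν u u = 1 ∧ p u u < 1 / ((k : ℝ) + 1) := fun k => by
    obtain ⟨r, ⟨x, hx, rfl⟩, hr⟩ := exists_lt_of_csInf_lt hne
      (show sInf S < E + 1 / ((k : ℝ) + 1) by rw [← hE]; simp; positivity)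
    exact ⟨x, hx, by rw [hpapp, hx]; linarith⟩
  choose u hu1 hup using hseq
  have hup0 : Tendsto (fun k => p (u k) (u k)) atTop (𝓝 0) :=
    squeeze_zero (fun k => hp0 _) (fun k => (hup k).le) tendsto_one_div_add_atTop_nhds_zero_nat
  have hzℓ : ℓ x₀ ≠ 0 := fun h => by
    have := hqℓ x₀; rw [h] at this; simp at this; linarith
  set z := (ℓ x₀)⁻¹ • x₀ with hz
  have hz1 : ℓ z = 1 := by simp [hz, hzℓ]
  -- The values `ℓ (u k)` lie in `[-√M, √M]`. This one-dimensional compactness is all that is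
  -- needed.
  obtain ⟨a, -, σ, hσ, ha⟩ := tendsto_subseq_of_bounded (s := Metric.closedBall (0 : ℝ) (√M))
    Metric.isBounded_closedBall (x := fun k => ℓ (u k)) (fun k => by
      rw [mem_closedBall_zero_iff, Real.norm_eq_abs]
      apply Real.abs_le_sqrt
      simpa [hu1] using hℓ (u k))
  refine ⟨E, hE0, u ∘ σ, fun k => hu1 _, ?_, fun y => ?_⟩
  -- Subtracting `c • z` moves the difference into the kernel of `ℓ`, where `q ≥ 0` and hence `p ≥
  -- -E ν` with `-E > 0`. The remainder is controlled by `p (u k) (u k)`, `p (u l) (u l)` and `c`,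
  -- all of which tend to zero.
  · have key : ∀ k l, ν (u k - u l) (u k - u l) ≤
        (2 / -E) * (4 * p (u k) (u k) + 4 * p (u l) (u l) + 2 * (ℓ (u k) - ℓ (u l)) ^ 2 * p z z)
          + 2 * (ℓ (u k) - ℓ (u l)) ^ 2 * ν z z := fun k l => by
      set c := ℓ (u k) - ℓ (u l) with hc
      set d := u k - u l with hd
      have hy : ℓ (d - c • z) = 0 := by simp [hd, hc, hz1]
      have h1 : -E * ν (d - c • z) (d - c • z) ≤ p (d - c • z) (d - c • z) := by
        have := hqℓ (d - c • z)
        rw [hy, zero_pow two_ne_zero, mul_zero] at this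
        rw [hpapp]; linarith
      have h2 := hsub p hp0 d (c • z)
      have h3 := hsub p hp0 (u k) (u l)
      have h4 := hadd ν hν0 (d - c • z) (c • z)
      rw [sub_add_cancel] at h4
      have h5 : p (c • z) (c • z) = c ^ 2 * p z z := by simp; ring
      have h6 : ν (c • z) (c • z) = c ^ 2 * ν z z := by simp; ring
      have h7 : ν (d - c • z) (d - c • z) ≤ (1 / -E) * p (d - c • z) (d - c • z) := by
        rw [div_mul_eq_mul_div, one_mul, le_div_iff₀ (by linarith)]; linarith
      have h8 : (1 / -E) * p (d - c • z) (d - c • z) ≤ (1 / -E) *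
          (4 * p (u k) (u k) + 4 * p (u l) (u l) + 2 * c ^ 2 * p z z) := by
        apply mul_le_mul_of_nonneg_left _ (by rw [one_div]; exact inv_nonneg.2 (by linarith))
        linarith
      have h9 : (2 / -E) * (4 * p (u k) (u k) + 4 * p (u l) (u l) + 2 * c ^ 2 * p z z) =
        2 * ((1 / -E) * (4 * p (u k) (u k) + 4 * p (u l) (u l) + 2 * c ^ 2 * p z z)) := by ring
      rw [h9]
      linarith
    have hlim : Tendsto (fun kl : ℕ × ℕ => (2 / -E) * (4 * p (u (σ kl.1)) (u (σ kl.1))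
        + 4 * p (u (σ kl.2)) (u (σ kl.2)) + 2 * (ℓ (u (σ kl.1)) - ℓ (u (σ kl.2))) ^ 2 * p z z)
          + 2 * (ℓ (u (σ kl.1)) - ℓ (u (σ kl.2))) ^ 2 * ν z z) (atTop ×ˢ atTop) (𝓝 0) := by
      have t1 : Tendsto (fun kl : ℕ × ℕ => p (u (σ kl.1)) (u (σ kl.1))) (atTop ×ˢ atTop) (𝓝 0) :=
        (hup0.comp hσ.tendsto_atTop).comp tendsto_fst
      have t2 : Tendsto (fun kl : ℕ × ℕ => p (u (σ kl.2)) (u (σ kl.2))) (atTop ×ˢ atTop) (𝓝 0) :=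
        (hup0.comp hσ.tendsto_atTop).comp tendsto_snd
      have t3 : Tendsto (fun kl : ℕ × ℕ => ℓ (u (σ kl.1))) (atTop ×ˢ atTop) (𝓝 a) :=
        ha.comp tendsto_fst
      have t4 : Tendsto (fun kl : ℕ × ℕ => ℓ (u (σ kl.2))) (atTop ×ˢ atTop) (𝓝 a) :=
        ha.comp tendsto_snd
      have t5 := ((t3.sub t4).pow 2).const_mul 2
      have := ((((t1.const_mul 4).add (t2.const_mul 4)).add (t5.mul_const (p z z))).const_mul
        (2 / -E)).add (t5.mul_const (ν z z))
      simpa using this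
    intro ε hε
    have := hlim.eventually_lt_const hε
    rw [prod_atTop_atTop_eq, eventually_atTop_prod_self] at this
    obtain ⟨N, hN⟩ := this
    exact ⟨N, fun k hk l hl => (key _ _).trans_lt (hN k l hk hl)⟩
  · have h1 : Tendsto (fun k => √(p (u (σ k)) (u (σ k)) * p y y)) atTop (𝓝 0) := by
      have := ((hup0.comp hσ.tendsto_atTop).mul_const (p y y)).sqrt
      simpa using this
    refine squeeze_zero_norm (fun k => ?_) h1
    simp only [Function.comp, ← hpapp]
    exact Real.abs_le_sqrt (hCS _ _)

/-! ### The space `H²`: elliptic regularity and density of Schwartz functions -/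

/-- The Fourier transform is normalized with `2π` in the exponent, so `-Δ` has symbol `(2π)²‖ξ‖²`
and the symbol `1 + ‖ξ‖²` belongs to `1 - (2π)⁻² Δ`. -/
theorem besselPotential_two {n : ℕ} (f : 𝓢'(Rn n, ℂ)) :
    besselPotential (Rn n) ℂ 2 f = f - (((2 * π) ^ 2)⁻¹ : ℝ) • Δ f := by
  have h : (fun x : Rn n => (((1 + ‖x‖ ^ 2) ^ ((2 : ℝ) / 2) : ℝ) : ℂ))
      = (fun _ => (1 : ℂ)) + fun x : Rn n => Complex.ofReal (‖x‖ ^ 2) := by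
    ext x; simp
  rw [besselPotential, h, laplacian_eq_fourierMultiplierCLM]
  simp only [fourierMultiplierCLM_apply]
  rw [smulLeftCLM_add (by fun_prop) (by fun_prop), smul_smul]
  have hpi : ((2 * π) ^ 2)⁻¹ * -(2 * π) ^ 2 = -1 := by
    field_simp
  rw [hpi]
  simp [FourierTransform.fourierInv_add, smulLeftCLM_const]

theorem besselPotential_two_eq_of_laplacian {n : ℕ} {f g : L2 n}
    (h : Δ (f : 𝓢'(Rn n, ℂ)) = (g : 𝓢'(Rn n, ℂ))) :
    besselPotential (Rn n) ℂ 2 (f : 𝓢'(Rn n, ℂ)) =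
      ((f - ((((2 * π) ^ 2)⁻¹ : ℝ) : ℂ) • g : L2 n) : 𝓢'(Rn n, ℂ)) := by
  rw [besselPotential_two, h, ← Lp.toTemperedDistributionCLM_apply,
    ← Lp.toTemperedDistributionCLM_apply, ← Lp.toTemperedDistributionCLM_apply, map_sub, map_smul,
    Complex.coe_smul]

/-- By the formula for the Bessel potential no mixed derivatives need to be examined. This puts the
weak eigenfunction into the operator domain. -/
theorem memSobolev_two_of_laplacian {n : ℕ} {f g : L2 n}
    (h : Δ (f : 𝓢'(Rn n, ℂ)) = (g : 𝓢'(Rn n, ℂ))) : f ∈ H2 n := by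
  exact ⟨_, besselPotential_two_eq_of_laplacian h⟩

theorem laplacianH2_eq_of_laplacian {n : ℕ} {f g : L2 n}
    (h : Δ (f : 𝓢'(Rn n, ℂ)) = (g : 𝓢'(Rn n, ℂ))) :
    laplacianH2 n ⟨f, memSobolev_two_of_laplacian h⟩ = g := by
  apply toTemperedDistribution_injective
  rw [← laplacianH2_spec, ← h]

/-- The embedding of Schwartz functions into `L²(ℝⁿ)`. -/
noncomputable def schwartzL2 (n : ℕ) : 𝓢(Rn n, ℂ) →L[ℂ] L2 n := SchwartzMap.toLpCLM ℂ ℂ 2 volume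

theorem coeFn_schwartzL2 {n : ℕ} (y : 𝓢(Rn n, ℂ)) : schwartzL2 n y =ᵐ[volume] y :=
  y.coeFn_toLp 2 volume

theorem inner_schwartzL2 {n : ℕ} (y z : 𝓢(Rn n, ℂ)) :
    inner ℂ (schwartzL2 n y) (schwartzL2 n z) = ∫ x, inner ℂ (y x) (z x) :=
  SchwartzMap.inner_toL2_toL2_eq y z volume

theorem denseRange_schwartzL2 (n : ℕ) : DenseRange (schwartzL2 n) :=
  SchwartzMap.denseRange_toLpCLM (E := Rn n) (F := ℂ) (p := 2) (by norm_num)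

theorem toTemperedDistribution_schwartzL2 {n : ℕ} (y : 𝓢(Rn n, ℂ)) :
    (schwartzL2 n y : 𝓢'(Rn n, ℂ)) = (y : 𝓢'(Rn n, ℂ)) :=
  Lp.toTemperedDistribution_toLp_eq (μ := volume) (p := 2) y

/-- The Laplacian on Schwartz functions. -/
noncomputable def schwartzLaplacian (n : ℕ) : 𝓢(Rn n, ℂ) →L[ℂ] 𝓢(Rn n, ℂ) :=
  LineDeriv.laplacianCLM ℂ (Rn n) 𝓢(Rn n, ℂ)

theorem schwartzLaplacian_eq {n : ℕ} (y : 𝓢(Rn n, ℂ)) : schwartzLaplacian n y = Δ y :=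
  (SchwartzMap.laplacianCLM_eq (𝕜 := ℂ) y)

theorem schwartzLaplacian_eq_sum {n : ℕ} (y : 𝓢(Rn n, ℂ)) :
    schwartzLaplacian n y = ∑ i, ∂_{EuclideanSpace.basisFun (Fin n) ℝ i}
      (∂_{EuclideanSpace.basisFun (Fin n) ℝ i} y) := by
  rw [schwartzLaplacian_eq, SchwartzMap.laplacian_eq_sum (EuclideanSpace.basisFun (Fin n) ℝ)]

theorem laplacian_schwartzL2 {n : ℕ} (y : 𝓢(Rn n, ℂ)) :
    Δ (schwartzL2 n y : 𝓢'(Rn n, ℂ)) = (schwartzL2 n (schwartzLaplacian n y) : 𝓢'(Rn n, ℂ)) := by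
  rw [toTemperedDistribution_schwartzL2, toTemperedDistribution_schwartzL2, schwartzLaplacian_eq,
    laplacian_toTemperedDistributionCLM_eq]

/-- `(v, w) ↦ conj v * w` as a real bilinear map on `ℂ`. -/
noncomputable def conjMul : ℂ →L[ℝ] ℂ →L[ℝ] ℂ :=
  (ContinuousLinearMap.mul ℝ ℂ).comp (Complex.conjCLE : ℂ →L[ℝ] ℂ)

theorem conjMul_apply (v w : ℂ) : conjMul v w = inner ℂ v w := by
  simp [conjMul, mul_comm]

theorem inner_schwartzL2_laplacian {n : ℕ} (y z : 𝓢(Rn n, ℂ)) :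
    inner ℂ (schwartzL2 n y) (schwartzL2 n (schwartzLaplacian n z)) =
      inner ℂ (schwartzL2 n (schwartzLaplacian n y)) (schwartzL2 n z) := by
  rw [inner_schwartzL2, inner_schwartzL2, schwartzLaplacian_eq, schwartzLaplacian_eq]
  simp only [← conjMul_apply]
  exact SchwartzMap.integral_bilinear_laplacian_right_eq_left y z conjMul

theorem re_inner_schwartzL2_laplacian_nonpos {n : ℕ} (y : 𝓢(Rn n, ℂ)) :
    (inner ℂ (schwartzL2 n y) (schwartzL2 n (schwartzLaplacian n y))).re ≤ 0 := by
  rw [schwartzLaplacian_eq_sum, map_sum, inner_sum, Complex.re_sum]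
  refine Finset.sum_nonpos fun i _ => ?_
  set e := EuclideanSpace.basisFun (Fin n) ℝ i
  have h2 : inner ℂ (schwartzL2 n y) (schwartzL2 n (∂_{e} (∂_{e} y))) =
      - inner ℂ (schwartzL2 n (∂_{e} y)) (schwartzL2 n (∂_{e} y)) := by
    rw [inner_schwartzL2, inner_schwartzL2]
    simp only [← conjMul_apply]
    exact SchwartzMap.integral_bilinear_lineDerivOp_right_eq_neg_left y _ conjMul _
  rw [h2, Complex.neg_re, neg_nonpos]
  exact inner_self_nonneg (𝕜 := ℂ)

/-- In the expansion of the square the cross term `-2a Re⟨y, Δy⟩` is nonnegative, so each of the two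
squares is bounded by the whole. Consequently convergence of `(1 - aΔ)y_k` forces that of `y_k` and
of `Δ y_k` separately. -/
theorem norm_schwartzL2_le_bessel {n : ℕ} {a : ℝ} (ha : 0 ≤ a) (y : 𝓢(Rn n, ℂ)) :
    ‖schwartzL2 n y‖ ≤ ‖schwartzL2 n y - (a : ℂ) • schwartzL2 n (schwartzLaplacian n y)‖ ∧
    a * ‖schwartzL2 n (schwartzLaplacian n y)‖ ≤
      ‖schwartzL2 n y - (a : ℂ) • schwartzL2 n (schwartzLaplacian n y)‖ := by
  set v := schwartzL2 n y with hv
  set w := schwartzL2 n (schwartzLaplacian n y) with hw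
  have h0 : (inner ℂ v w).re ≤ 0 := re_inner_schwartzL2_laplacian_nonpos y
  clear_value v w
  have h := norm_sub_sq (𝕜 := ℂ) v ((a : ℂ) • w)
  rw [inner_smul_right, norm_smul, Complex.norm_real, Real.norm_of_nonneg ha] at h
  simp only [RCLike.re_to_complex, Complex.re_ofReal_mul] at h
  have h1 : a * (inner ℂ v w).re ≤ 0 := mul_nonpos_of_nonneg_of_nonpos ha h0
  constructor <;> refine le_of_sq_le_sq ?_ (norm_nonneg _) <;> rw [h]
  · nlinarith [sq_nonneg (a * ‖w‖)]
  · nlinarith [sq_nonneg ‖v‖]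

/-- The solution is given by the Fourier multiplier `(1 + ‖ξ‖²)⁻¹`, which preserves Schwartz
functions. -/
theorem exists_schwartz_sub_laplacian {n : ℕ} (h : 𝓢(Rn n, ℂ)) :
    ∃ y : 𝓢(Rn n, ℂ), y - (((2 * π) ^ 2)⁻¹ : ℝ) • Δ y = h := by
  refine ⟨SchwartzMap.fourierMultiplierCLM ℂ
    (fun x : Rn n => ((1 + ‖x‖ ^ 2) ^ (-1 : ℝ) : ℝ)) h, ?_⟩
  have hg : (fun x : Rn n => ((1 + ‖x‖ ^ 2) ^ (-1 : ℝ) : ℝ)).HasTemperateGrowth := by fun_prop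
  have hg2 : (fun x : Rn n => ‖x‖ ^ 2 * ((1 + ‖x‖ ^ 2) ^ (-1 : ℝ) : ℝ)).HasTemperateGrowth := by
    fun_prop
  rw [SchwartzMap.laplacian_eq_fourierMultiplierCLM]
  have hpi : ((2 * π) ^ 2)⁻¹ * -(2 * π) ^ 2 = -1 := by field_simp
  rw [smul_smul, hpi, neg_one_smul, sub_neg_eq_add,
    SchwartzMap.fourierMultiplierCLM_fourierMultiplierCLM_apply (by fun_prop) hg]
  -- Additivity in the symbol, for the two symbols `(1 + ‖ξ‖²)⁻¹` and `‖ξ‖² (1 + ‖ξ‖²)⁻¹`, whose sum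
  -- is `1`.
  have h1 := SchwartzMap.fourierMultiplierCLM_sum ℂ (s := (Finset.univ : Finset (Fin 2)))
    (g := fun i => if i = 0 then (fun x : Rn n => ((1 + ‖x‖ ^ 2) ^ (-1 : ℝ) : ℝ))
      else (fun x : Rn n => ‖x‖ ^ 2 * ((1 + ‖x‖ ^ 2) ^ (-1 : ℝ) : ℝ)))
    (fun i _ => by fin_cases i <;> simpa)
  simp only [Fin.sum_univ_two] at h1
  have h2 := congrArg (fun T => T h) h1
  simp only [add_apply, if_true, one_ne_zero, if_false] at h2
  have h3 : (fun x : Rn n => ((1 + ‖x‖ ^ 2) ^ (-1 : ℝ) : ℝ)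
      + ‖x‖ ^ 2 * ((1 + ‖x‖ ^ 2) ^ (-1 : ℝ) : ℝ)) = fun _ => 1 := by
    ext x
    rw [Real.rpow_neg_one]
    have : 1 + ‖x‖ ^ 2 ≠ 0 := by positivity
    field_simp
  refine Eq.trans h2.symm ?_
  rw [h3, SchwartzMap.fourierMultiplierCLM_const]
  simp

/-- The Laplacian is continuous on tempered distributions, hence closed on `L²`. -/
theorem laplacian_eq_of_tendsto {n : ℕ} {y : ℕ → 𝓢(Rn n, ℂ)} {u g : L2 n}
    (hu : Tendsto (fun k => schwartzL2 n (y k)) atTop (𝓝 u))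
    (hg : Tendsto (fun k => schwartzL2 n (schwartzLaplacian n (y k))) atTop (𝓝 g)) :
    Δ (u : 𝓢'(Rn n, ℂ)) = (g : 𝓢'(Rn n, ℂ)) := by
  set T := Lp.toTemperedDistributionCLM ℂ (volume : Measure (Rn n)) 2 with hT
  set D := LineDeriv.laplacianCLM ℂ (Rn n) 𝓢'(Rn n, ℂ) with hD
  have h1 : Tendsto (fun k => D (T (schwartzL2 n (y k)))) atTop (𝓝 (D (T u))) :=
    ((D.continuous.comp T.continuous).tendsto u).comp hu
  have h2 : Tendsto (fun k => T (schwartzL2 n (schwartzLaplacian n (y k)))) atTop (𝓝 (T g)) :=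
    (T.continuous.tendsto g).comp hg
  have h3 : ∀ k, D (T (schwartzL2 n (y k))) = T (schwartzL2 n (schwartzLaplacian n (y k))) :=
    fun k => by
      rw [hD, laplacianCLM_apply]
      exact laplacian_schwartzL2 (y k)
  simp only [h3] at h1
  have h4 := tendsto_nhds_unique h1 h2
  rwa [hD, laplacianCLM_apply] at h4

theorem cauchySeq_of_norm_sub_le {H H' : Type*} [NormedAddCommGroup H] [NormedAddCommGroup H']
    {v : ℕ → H} {w : ℕ → H'} {a : ℝ} (ha : 0 < a) (h : ∀ k l, a * ‖w k - w l‖ ≤ ‖v k - v l‖)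
    (hv : CauchySeq v) : CauchySeq w := by
  rw [Metric.cauchySeq_iff] at hv ⊢
  intro ε hε
  obtain ⟨N, hN⟩ := hv (a * ε) (by positivity)
  refine ⟨N, fun k hk l hl => ?_⟩
  have h1 := hN k hk l hl
  rw [dist_eq_norm] at h1 ⊢
  exact lt_of_mul_lt_mul_left ((h k l).trans_lt h1) ha.le

/-- Schwartz functions are dense in `H²` for the graph norm of the Laplacian. -/
theorem exists_schwartz_tendsto {n : ℕ} (u : H2 n) :
    ∃ y : ℕ → 𝓢(Rn n, ℂ), Tendsto (fun k => schwartzL2 n (y k)) atTop (𝓝 (u : L2 n)) ∧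
      Tendsto (fun k => schwartzL2 n (schwartzLaplacian n (y k))) atTop
        (𝓝 (laplacianH2 n u)) := by
  set a : ℝ := ((2 * π) ^ 2)⁻¹ with ha
  have ha0 : 0 < a := by positivity
  -- Approximate `(1 - aΔ)u` rather than `u`, then solve for the approximants; the limit is
  -- identified with `u` because the Bessel potential of order two is inverted by the one of order
  -- `-2`.
  obtain ⟨v, hv, hvl⟩ := mem_closure_iff_seq_limit.1
    (denseRange_schwartzL2 n ((u : L2 n) - (a : ℂ) • laplacianH2 n u))
  have hex : ∀ k, ∃ y : 𝓢(Rn n, ℂ),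
      schwartzL2 n y - (a : ℂ) • schwartzL2 n (schwartzLaplacian n y) = v k := by
    intro k
    obtain ⟨h, hh⟩ := hv k
    obtain ⟨y, hy⟩ := exists_schwartz_sub_laplacian h
    refine ⟨y, ?_⟩
    rw [← hh, ← hy, map_sub, ← schwartzLaplacian_eq, ← map_smul, Complex.coe_smul]
  choose y hy using hex
  have hbd : ∀ k l, schwartzL2 n (y k - y l) -
      (a : ℂ) • schwartzL2 n (schwartzLaplacian n (y k - y l)) = v k - v l := by
    intro k l
    rw [map_sub, map_sub, map_sub, ← hy, ← hy, smul_sub]; abel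
  have hvc : CauchySeq v := hvl.cauchySeq
  obtain ⟨u', hu'⟩ := cauchySeq_tendsto_of_complete
    (cauchySeq_of_norm_sub_le (w := fun k => schwartzL2 n (y k)) one_pos (fun k l => by
      rw [← hbd, one_mul, ← map_sub]
      exact (norm_schwartzL2_le_bessel ha0.le _).1) hvc)
  obtain ⟨g', hg'⟩ := cauchySeq_tendsto_of_complete
    (cauchySeq_of_norm_sub_le (w := fun k => schwartzL2 n (schwartzLaplacian n (y k))) ha0
      (fun k l => by
        rw [← hbd, ← map_sub, ← map_sub]
        exact (norm_schwartzL2_le_bessel ha0.le _).2) hvc)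
  have hΔ := laplacian_eq_of_tendsto hu' hg'
  have hlim : u' - (a : ℂ) • g' = (u : L2 n) - (a : ℂ) • laplacianH2 n u := by
    refine tendsto_nhds_unique (hu'.sub (hg'.const_smul (a : ℂ))) ?_
    simp only [hy]
    exact hvl
  have hbu := besselPotential_two_eq_of_laplacian (laplacianH2_spec u)
  rw [← hlim, ← besselPotential_two_eq_of_laplacian hΔ] at hbu
  have huu : (u : L2 n) = u' := by
    apply toTemperedDistribution_injective
    have := congrArg (besselPotential (Rn n) ℂ (-2)) hbu
    simpa using this
  have hgg : laplacianH2 n u = g' := by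
    apply toTemperedDistribution_injective
    rw [← laplacianH2_spec, huu, hΔ]
  exact ⟨y, huu ▸ hu', hgg ▸ hg'⟩

theorem inner_laplacianH2 {n : ℕ} (u v : H2 n) :
    inner ℂ (u : L2 n) (laplacianH2 n v) = inner ℂ (laplacianH2 n u) (v : L2 n) := by
  obtain ⟨y, hy, hyΔ⟩ := exists_schwartz_tendsto u
  obtain ⟨z, hz, hzΔ⟩ := exists_schwartz_tendsto v
  refine tendsto_nhds_unique (hy.inner hzΔ) ?_
  simp only [inner_schwartzL2_laplacian]
  exact hyΔ.inner hz

/-! ### The class of bounded `C¹` functions in `H¹` -/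

/-- Bounded `C¹` functions that belong to `H¹(ℝⁿ)`. -/
structure IsBddH1 {n : ℕ} (u : Rn n → ℝ) : Prop where
  contDiff : ContDiff ℝ 1 u
  bounded : ∃ M, ∀ x, |u x| ≤ M
  memLp : MemLp u 2
  memLp_grad : MemLp (∇ u) 2

theorem inner_gradient {n : ℕ} {u : Rn n → ℝ} (x v : Rn n) :
    inner ℝ (∇ u x) v = fderiv ℝ u x v := by
  rw [gradient, InnerProductSpace.toDual_symm_apply]

theorem norm_gradient {n : ℕ} {u : Rn n → ℝ} (x : Rn n) : ‖∇ u x‖ = ‖fderiv ℝ u x‖ := by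
  rw [gradient, LinearIsometryEquiv.norm_map]

theorem continuous_gradient {n : ℕ} {u : Rn n → ℝ} (hu : ContDiff ℝ 1 u) : Continuous (∇ u) :=
  (InnerProductSpace.toDual ℝ (Rn n)).symm.continuous.comp (hu.continuous_fderiv one_ne_zero)

theorem gradient_add' {n : ℕ} {u v : Rn n → ℝ} (hu : ContDiff ℝ 1 u) (hv : ContDiff ℝ 1 v) :
    ∇ (fun x => u x + v x) = fun x => ∇ u x + ∇ v x := by
  ext1 x
  have : fderiv ℝ (fun x => u x + v x) x = fderiv ℝ u x + fderiv ℝ v x :=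
    fderiv_add (hu.differentiable one_ne_zero x) (hv.differentiable one_ne_zero x)
  simp only [gradient, this, map_add]

theorem gradient_const_mul' {n : ℕ} {u : Rn n → ℝ} (hu : ContDiff ℝ 1 u) (c : ℝ) :
    ∇ (fun x => c * u x) = fun x => c • ∇ u x := by
  ext1 x
  have : fderiv ℝ (fun x => c * u x) x = c • fderiv ℝ u x :=
    fderiv_const_mul (hu.differentiable one_ne_zero x) c
  simp only [gradient, this, map_smul]

theorem gradient_mul' {n : ℕ} {u v : Rn n → ℝ} (hu : ContDiff ℝ 1 u) (hv : ContDiff ℝ 1 v) :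
    ∇ (fun x => u x * v x) = fun x => u x • ∇ v x + v x • ∇ u x := by
  ext1 x
  have : fderiv ℝ (fun x => u x * v x) x = u x • fderiv ℝ v x + v x • fderiv ℝ u x :=
    fderiv_mul (hu.differentiable one_ne_zero x) (hv.differentiable one_ne_zero x)
  simp only [gradient, this, map_add, map_smul]

namespace IsBddH1

variable {n : ℕ} {u v : Rn n → ℝ}

theorem add (hu : IsBddH1 u) (hv : IsBddH1 v) : IsBddH1 fun x => u x + v x where
  contDiff := hu.contDiff.add hv.contDiff
  bounded := by
    obtain ⟨M, hM⟩ := hu.bounded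
    obtain ⟨M', hM'⟩ := hv.bounded
    exact ⟨M + M', fun x => (abs_add_le _ _).trans (add_le_add (hM x) (hM' x))⟩
  memLp := hu.memLp.add hv.memLp
  memLp_grad := by
    rw [gradient_add' hu.contDiff hv.contDiff]
    exact hu.memLp_grad.add hv.memLp_grad

theorem const_mul (hu : IsBddH1 u) (c : ℝ) : IsBddH1 fun x => c * u x where
  contDiff := contDiff_const.mul hu.contDiff
  bounded := by
    obtain ⟨M, hM⟩ := hu.bounded
    exact ⟨|c| * M, fun x => by rw [abs_mul]; exact mul_le_mul_of_nonneg_left (hM x) (abs_nonneg c)⟩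
  memLp := hu.memLp.const_mul c
  memLp_grad := by
    rw [gradient_const_mul' hu.contDiff]
    exact hu.memLp_grad.const_smul c

theorem of_hasCompactSupport (hu : ContDiff ℝ 1 u) (hc : HasCompactSupport u) : IsBddH1 u where
  contDiff := hu
  bounded := by
    obtain ⟨M, hM⟩ := hu.continuous.bounded_above_of_compact_support hc
    exact ⟨M, hM⟩
  memLp := hu.continuous.memLp_of_hasCompactSupport hc
  memLp_grad := by
    refine (continuous_gradient hu).memLp_of_hasCompactSupport ?_
    exact (hc.fderiv ℝ).comp_left (map_zero (InnerProductSpace.toDual ℝ (Rn n)).symm)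

theorem integrable_mul (hu : IsBddH1 u) (hv : IsBddH1 v) : Integrable fun x => u x * v x :=
  hu.memLp.integrable_mul hv.memLp

theorem integrable_inner (hu : IsBddH1 u) (hv : IsBddH1 v) :
    Integrable fun x => inner ℝ (∇ u x) (∇ v x) :=
  (hu.memLp_grad.norm.integrable_mul hv.memLp_grad.norm).mono'
    ((continuous_gradient hu.contDiff).inner (continuous_gradient hv.contDiff)).aestronglyMeasurable
    (Eventually.of_forall fun x => norm_inner_le_norm _ _)

end IsBddH1

/-- `∫ |∇u|²`. -/
noncomputable def dirichlet {n : ℕ} (u : Rn n → ℝ) : ℝ := ∫ x, ‖∇ u x‖ ^ 2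

theorem dirichlet_add_const_mul {n : ℕ} {u v : Rn n → ℝ} (hu : IsBddH1 u) (hv : IsBddH1 v)
    (ε : ℝ) : dirichlet (fun x => u x + ε * v x) =
      dirichlet u + 2 * ε * (∫ x, inner ℝ (∇ u x) (∇ v x)) + ε ^ 2 * dirichlet v := by
  have h : ∀ x, ‖∇ (fun x => u x + ε * v x) x‖ ^ 2 = ‖∇ u x‖ ^ 2
      + 2 * ε * inner ℝ (∇ u x) (∇ v x) + ε ^ 2 * ‖∇ v x‖ ^ 2 := fun x => by
    rw [gradient_add' hu.contDiff (hv.const_mul ε).contDiff, gradient_const_mul' hv.contDiff]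
    simp only
    rw [norm_add_sq_real, inner_smul_right, norm_smul, mul_pow, Real.norm_eq_abs, sq_abs]
    ring
  have i1 : Integrable fun x => ‖∇ u x‖ ^ 2 := hu.memLp_grad.integrable_norm_pow two_ne_zero
  have i2 : Integrable fun x => ‖∇ v x‖ ^ 2 := hv.memLp_grad.integrable_norm_pow two_ne_zero
  have i3 := (hu.integrable_inner hv).const_mul (2 * ε)
  simp only [dirichlet, h]
  rw [integral_add (by exact i1.add i3) (i2.const_mul _), integral_add i1 i3, integral_const_mul,
    integral_const_mul]

/-! ### Integral functionals and their derivatives -/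

/-- A `C²` potential `g` with derivatives `f` and `f'` such that `g(0) = g'(0) = 0`. -/
structure IsPotential (g f f' : ℝ → ℝ) : Prop where
  hasDerivAt : ∀ s, HasDerivAt g (f s) s
  hasDerivAt' : ∀ s, HasDerivAt f (f' s) s
  continuous' : Continuous f'
  zero : g 0 = 0
  zero' : f 0 = 0

namespace IsPotential

variable {g f f' : ℝ → ℝ}

theorem continuous (h : IsPotential g f f') : Continuous g :=
  continuous_iff_continuousAt.2 fun s => (h.hasDerivAt s).continuousAt

theorem continuous_deriv (h : IsPotential g f f') : Continuous f :=
  continuous_iff_continuousAt.2 fun s => (h.hasDerivAt' s).continuousAt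

/-- The mean value inequality, applied twice from the bound on `f'`. On a bounded range this
replaces any growth condition, which is why the test class consists of bounded functions. -/
theorem exists_bound (h : IsPotential g f f') (M : ℝ) :
    ∃ C, 0 ≤ C ∧ ∀ s, |s| ≤ M → |f' s| ≤ C ∧ |f s| ≤ C * |s| ∧ |g s| ≤ C * s ^ 2 := by
  obtain ⟨C, hC⟩ := (isCompact_Icc (a := -M) (b := M)).exists_bound_of_continuousOn
    h.continuous'.continuousOn
  -- The maximum with `0` covers negative `M`, where the interval is empty and `C` may be negative.
  have hC' : ∀ s, |s| ≤ M → |f' s| ≤ max C 0 := fun s hs =>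
    (hC s (abs_le.1 hs)).trans (le_max_left _ _)
  have hf : ∀ s, |s| ≤ M → |f s| ≤ max C 0 * |s| := fun s hs => by
    have := (convex_Icc (-|s|) |s|).norm_image_sub_le_of_norm_hasDerivWithin_le
      (f := f) (f' := f') (C := max C 0) (fun x _ => (h.hasDerivAt' x).hasDerivWithinAt)
      (fun x hx => hC' x ((abs_le.2 hx).trans hs))
      (show (0 : ℝ) ∈ Set.Icc (-|s|) |s| by simp) (show s ∈ Set.Icc (-|s|) |s| from abs_le.1 le_rfl)
    simpa [h.zero'] using this
  refine ⟨max C 0, le_max_right _ _, fun s hs => ⟨hC' s hs, hf s hs, ?_⟩⟩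
  have := (convex_Icc (-|s|) |s|).norm_image_sub_le_of_norm_hasDerivWithin_le
      (f := g) (f' := f) (C := max C 0 * |s|) (fun x _ => (h.hasDerivAt x).hasDerivWithinAt)
      (fun x hx => (hf x ((abs_le.2 hx).trans hs)).trans
        (mul_le_mul_of_nonneg_left (abs_le.2 hx) (le_max_right _ _)))
      (show (0 : ℝ) ∈ Set.Icc (-|s|) |s| by simp) (show s ∈ Set.Icc (-|s|) |s| from abs_le.1 le_rfl)
  rw [h.zero, sub_zero, sub_zero, Real.norm_eq_abs, Real.norm_eq_abs, mul_assoc, abs_mul_abs_self]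
    at this
  rwa [pow_two]

theorem integrable_comp (h : IsPotential g f f') {n : ℕ} {u : Rn n → ℝ} (hu : IsBddH1 u) :
    Integrable fun x => g (u x) := by
  obtain ⟨M, hM⟩ := hu.bounded
  obtain ⟨C, -, hC⟩ := h.exists_bound M
  have i1 : Integrable fun x => u x ^ 2 := hu.memLp.integrable_sq
  refine (i1.const_mul C).mono' (h.continuous.comp hu.contDiff.continuous).aestronglyMeasurable
    (Eventually.of_forall fun x => (hC _ (hM x)).2.2)

theorem memLp_deriv_comp (h : IsPotential g f f') {n : ℕ} {u : Rn n → ℝ} (hu : IsBddH1 u) :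
    MemLp (fun x => f (u x)) 2 := by
  obtain ⟨M, hM⟩ := hu.bounded
  obtain ⟨C, -, hC⟩ := h.exists_bound M
  exact hu.memLp.of_le_mul (c := C)
    (h.continuous_deriv.comp hu.contDiff.continuous).aestronglyMeasurable
    (Eventually.of_forall fun x => (hC _ (hM x)).2.1)

theorem hasDerivAt_integral (h : IsPotential g f f') {n : ℕ} {u v : Rn n → ℝ} (hu : IsBddH1 u)
    (hv : IsBddH1 v) {ε : ℝ} (hε : ε ∈ Metric.ball (0 : ℝ) 1) :
    HasDerivAt (fun ε => ∫ x, g (u x + ε * v x)) (∫ x, f (u x + ε * v x) * v x) ε := by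
  obtain ⟨M, hM⟩ := hu.bounded
  obtain ⟨M', hM'⟩ := hv.bounded
  obtain ⟨C, hC0, hC⟩ := h.exists_bound (M + M')
  have hle : ∀ x, ∀ t ∈ Metric.ball (0 : ℝ) 1, |u x + t * v x| ≤ |u x| + |v x| := fun x t ht => by
    refine (abs_add_le _ _).trans (add_le_add le_rfl ?_)
    rw [abs_mul]
    have : |t| ≤ 1 := by simpa using (mem_ball_zero_iff.1 ht).le
    nlinarith [abs_nonneg (v x)]
  have hbound : Integrable fun x => C * (|u x| + |v x|) * |v x| := by
    have := (hu.memLp.norm.add hv.memLp.norm).integrable_mul hv.memLp.norm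
    simpa [mul_assoc] using this.const_mul C
  refine (hasDerivAt_integral_of_dominated_loc_of_deriv_le (μ := (volume : Measure (Rn n)))
    (F := fun t x => g (u x + t * v x)) (F' := fun t x => f (u x + t * v x) * v x) (Metric.isOpen_ball.mem_nhds hε)
    (Eventually.of_forall fun t => ?_) (h.integrable_comp (hu.add (hv.const_mul ε)))
    ?_ (Eventually.of_forall fun x t ht => ?_) hbound (Eventually.of_forall fun x t ht => ?_)).2
  · exact (h.continuous.comp (hu.contDiff.continuous.add
      (continuous_const.mul hv.contDiff.continuous))).aestronglyMeasurable
  · exact ((h.continuous_deriv.comp (hu.contDiff.continuous.add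
      (continuous_const.mul hv.contDiff.continuous))).mul hv.contDiff.continuous).aestronglyMeasurable
  · rw [norm_mul, Real.norm_eq_abs, Real.norm_eq_abs]
    refine mul_le_mul_of_nonneg_right ?_ (abs_nonneg _)
    exact ((hC _ ((hle x t ht).trans (add_le_add (hM x) (hM' x)))).2.1).trans
      (mul_le_mul_of_nonneg_left (hle x t ht) hC0)
  · have h1 : HasDerivAt (fun t => u x + t * v x) (v x) t := by
      simpa using ((hasDerivAt_id t).mul_const (v x)).const_add (u x)
    exact (h.hasDerivAt _).comp t h1

theorem hasDerivAt_integral_deriv (h : IsPotential g f f') {n : ℕ} {u v : Rn n → ℝ}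
    (hu : IsBddH1 u) (hv : IsBddH1 v) :
    HasDerivAt (fun ε => ∫ x, f (u x + ε * v x) * v x) (∫ x, f' (u x) * v x ^ 2) 0 := by
  obtain ⟨M, hM⟩ := hu.bounded
  obtain ⟨M', hM'⟩ := hv.bounded
  obtain ⟨C, hC0, hC⟩ := h.exists_bound (M + M')
  have hle : ∀ x, ∀ t ∈ Metric.ball (0 : ℝ) 1, |u x + t * v x| ≤ |u x| + |v x| := fun x t ht => by
    refine (abs_add_le _ _).trans (add_le_add le_rfl ?_)
    rw [abs_mul]
    have : |t| ≤ 1 := by simpa using (mem_ball_zero_iff.1 ht).le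
    nlinarith [abs_nonneg (v x)]
  have i1 : Integrable fun x => v x ^ 2 := hv.memLp.integrable_sq
  have hcont : ∀ t : ℝ, Continuous fun x => u x + t * v x := fun t =>
    hu.contDiff.continuous.add (continuous_const.mul hv.contDiff.continuous)
  have := (hasDerivAt_integral_of_dominated_loc_of_deriv_le (μ := (volume : Measure (Rn n)))
    (F := fun t x => f (u x + t * v x) * v x) (F' := fun t x => f' (u x + t * v x) * v x ^ 2)
    (bound := fun x => C * v x ^ 2) (x₀ := 0) (Metric.ball_mem_nhds (0 : ℝ) one_pos)
    (Eventually.of_forall fun t => ?_) ?_ ?_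
    (Eventually.of_forall fun x t ht => ?_) (i1.const_mul C)
    (Eventually.of_forall fun x t ht => ?_)).2
  · simpa using this
  · exact ((h.continuous_deriv.comp (hcont t)).mul hv.contDiff.continuous).aestronglyMeasurable
  · simp only [zero_mul, add_zero]
    exact (h.memLp_deriv_comp hu).integrable_mul hv.memLp
  · exact ((h.continuous'.comp (hcont 0)).mul (hv.contDiff.continuous.pow 2)).aestronglyMeasurable
  · rw [norm_mul, Real.norm_eq_abs, Real.norm_eq_abs, abs_of_nonneg (sq_nonneg (v x))]
    exact mul_le_mul_of_nonneg_right
      (hC _ ((hle x t ht).trans (add_le_add (hM x) (hM' x)))).1 (sq_nonneg _)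
  · have h1 : HasDerivAt (fun t => u x + t * v x) (v x) t := by
      simpa using ((hasDerivAt_id t).mul_const (v x)).const_add (u x)
    have h2 := ((h.hasDerivAt' (u x + t * v x)).comp t h1).mul_const (v x)
    refine h2.congr_deriv ?_
    ring

end IsPotential

/-! ### First and second variation of the quotient -/

/-- Were the second derivative negative, `0` would be a local maximum as well, `Φ` would be locally
constant, and its second derivative would vanish. -/
theorem second_deriv_nonneg_of_isLocalMin {Φ Φ₁ : ℝ → ℝ} {Φ₂ : ℝ}
    (h1 : ∀ᶠ ε in 𝓝 0, HasDerivAt Φ (Φ₁ ε) ε) (h2 : HasDerivAt Φ₁ Φ₂ 0) (hmin : IsLocalMin Φ 0) :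
    Φ₁ 0 = 0 ∧ 0 ≤ Φ₂ := by
  have h10 : Φ₁ 0 = 0 := hmin.hasDerivAt_eq_zero h1.self_of_nhds
  refine ⟨h10, ?_⟩
  by_contra! hneg
  have hd : deriv Φ =ᶠ[𝓝 0] Φ₁ := h1.mono fun ε h => h.deriv
  have hdd : deriv (deriv Φ) 0 = Φ₂ := by rw [hd.deriv_eq, h2.deriv]
  have hmax : IsLocalMax Φ 0 := isLocalMax_of_deriv_deriv_neg (hdd ▸ hneg)
    (by rw [hd.self_of_nhds, h10]) h1.self_of_nhds.continuousAt
  have hconst : Φ =ᶠ[𝓝 0] fun _ => Φ 0 := by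
    filter_upwards [hmin, hmax] with ε ha hb using le_antisymm hb ha
  have : deriv Φ =ᶠ[𝓝 0] fun _ => 0 := by
    have := hconst.deriv
    simpa using this
  rw [this.deriv_eq] at hdd
  simp at hdd
  linarith

/-- `φ` minimizes `∫ |∇u|² / (∫ g(u)) ^ θ` among bounded `C¹` functions in `H¹`. -/
structure IsQuotientMin {n : ℕ} (g : ℝ → ℝ) (θ : ℝ) (φ : Rn n → ℝ) : Prop where
  isBddH1 : IsBddH1 φ
  pos : 0 < ∫ x, g (φ x)
  le : ∀ u : Rn n → ℝ, IsBddH1 u → 0 < ∫ x, g (u x) →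
    dirichlet φ * ((∫ x, g (u x)) / ∫ x, g (φ x)) ^ θ ≤ dirichlet u

/-- First and second variation of the quotient. -/
theorem IsQuotientMin.variation {n : ℕ} {g f f' : ℝ → ℝ} {θ : ℝ} {φ : Rn n → ℝ}
    (h : IsQuotientMin g θ φ) (hg : IsPotential g f f') {ψ : Rn n → ℝ} (hψ : IsBddH1 ψ)
    {μ : ℝ} (hμ : μ = dirichlet φ * θ / ∫ x, g (φ x)) :
    2 * (∫ x, inner ℝ (∇ φ x) (∇ ψ x)) = μ * ∫ x, f (φ x) * ψ x ∧
      μ / 2 * (∫ x, f' (φ x) * ψ x ^ 2)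
        + μ * (θ - 1) / (2 * ∫ x, g (φ x)) * (∫ x, f (φ x) * ψ x) ^ 2 ≤ dirichlet ψ := by
  have hφ := h.isBddH1
  set W₀ := ∫ x, g (φ x) with hW₀
  have hpos : 0 < W₀ := h.pos
  set W : ℝ → ℝ := fun ε => ∫ x, g (φ x + ε * ψ x) with hW
  set W₁ : ℝ → ℝ := fun ε => ∫ x, f (φ x + ε * ψ x) * ψ x with hW₁
  set B := ∫ x, inner ℝ (∇ φ x) (∇ ψ x) with hB
  have hW00 : W 0 = W₀ := by simp [hW, hW₀]
  have hW10 : W₁ 0 = ∫ x, f (φ x) * ψ x := by simp [hW₁]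
  have dW : ∀ ε ∈ Metric.ball (0 : ℝ) 1, HasDerivAt W (W₁ ε) ε := fun ε hε =>
    hg.hasDerivAt_integral hφ hψ hε
  have dW₁ := hg.hasDerivAt_integral_deriv hφ hψ
  have d0 := dW 0 (Metric.mem_ball_self one_pos)
  have hev : ∀ᶠ ε in 𝓝 (0 : ℝ), 0 < W ε :=
    d0.continuousAt.eventually_const_lt (by rw [hW00]; exact hpos)
  set J₀ := dirichlet φ with hJ₀
  -- Minimality of the quotient written without a division: `Φ ≥ 0` near `0`, with equality at `0`.
  set Φ : ℝ → ℝ := fun ε => J₀ + 2 * ε * B + ε ^ 2 * dirichlet ψ - J₀ * (W ε / W₀) ^ θ with hΦ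
  have hmin : IsLocalMin Φ 0 := by
    filter_upwards [hev] with ε hε
    have h1 := h.le _ (hφ.add (hψ.const_mul ε)) hε
    rw [dirichlet_add_const_mul hφ hψ] at h1
    have h2 : Φ 0 = 0 := by simp [hΦ, hW00, hpos.ne']
    rw [h2]
    simp only [hΦ]
    linarith
  set Φ₁ : ℝ → ℝ := fun ε => 2 * B + 2 * ε * dirichlet ψ
    - J₀ * (W₁ ε / W₀ * θ * (W ε / W₀) ^ (θ - 1)) with hΦ₁
  have dΦ : ∀ᶠ ε in 𝓝 0, HasDerivAt Φ (Φ₁ ε) ε := by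
    filter_upwards [hev, Metric.ball_mem_nhds (0 : ℝ) one_pos] with ε h1 h2
    have e1 := ((dW ε h2).div_const W₀).rpow_const (p := θ) (Or.inl (div_pos h1 hpos).ne')
    have e2 : HasDerivAt (fun ε : ℝ => J₀ + 2 * ε * B + ε ^ 2 * dirichlet ψ)
        (2 * B + 2 * ε * dirichlet ψ) ε := by
      have e3 := (((hasDerivAt_id ε).const_mul 2).mul_const B).const_add J₀
      have e4 := ((hasDerivAt_id ε).pow 2).mul_const (dirichlet ψ)
      refine (e3.add e4).congr_deriv ?_
      simp
    exact e2.sub (e1.const_mul J₀)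
  have dΦ₁ : HasDerivAt Φ₁ (2 * dirichlet ψ - J₀ * ((∫ x, f' (φ x) * ψ x ^ 2) / W₀ * θ
      + W₁ 0 / W₀ * θ * (W₁ 0 / W₀ * (θ - 1)))) 0 := by
    have e1 := (d0.div_const W₀).rpow_const (p := θ - 1)
      (Or.inl (by rw [hW00]; exact (div_pos hpos hpos).ne'))
    have e2 := (((dW₁.div_const W₀).mul_const θ).mul e1).const_mul J₀
    have e3 := (((hasDerivAt_id (0 : ℝ)).const_mul 2).mul_const (dirichlet ψ)).const_add (2 * B)
    refine (e3.sub e2).congr_deriv ?_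
    simp [hW00, hpos.ne', hW₁]
  obtain ⟨r1, r2⟩ := second_deriv_nonneg_of_isLocalMin dΦ dΦ₁ hmin
  rw [← hW10]
  clear_value W₁
  constructor
  · simp only [hΦ₁, hW00, div_self hpos.ne', Real.one_rpow] at r1
    rw [hμ]
    field_simp
    field_simp at r1
    linarith
  · have e : J₀ * ((∫ x, f' (φ x) * ψ x ^ 2) / W₀ * θ + W₁ 0 / W₀ * θ * (W₁ 0 / W₀ * (θ - 1)))
      = 2 * (μ / 2 * (∫ x, f' (φ x) * ψ x ^ 2) + μ * (θ - 1) / (2 * W₀) * W₁ 0 ^ 2) := by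
      rw [hμ]; field_simp
    linarith

/-! ### Dilations -/

theorem gradient_comp_smul {n : ℕ} {u : Rn n → ℝ} (hu : ContDiff ℝ 1 u) (t : ℝ) :
    ∇ (fun x => u (t • x)) = fun x => t • ∇ u (t • x) := by
  ext1 x
  have h1 : HasFDerivAt (fun x : Rn n => t • x) (t • ContinuousLinearMap.id ℝ (Rn n)) x :=
    (hasFDerivAt_id x).const_smul t
  have h2 := ((hu.differentiable one_ne_zero (t • x)).hasFDerivAt).comp x h1
  have h3 : fderiv ℝ (fun x => u (t • x)) x = t • fderiv ℝ u (t • x) := by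
    refine h2.fderiv.trans ?_
    ext v; simp
  simp only [gradient, h3, map_smul]

theorem integral_comp_smul' {n : ℕ} (h : Rn n → ℝ) {t : ℝ} (ht : 0 < t) :
    ∫ x, h (t • x) = (t ^ n)⁻¹ * ∫ x, h x := by
  rw [Measure.integral_comp_smul, finrank_euclideanSpace_fin, abs_of_pos (by positivity),
    smul_eq_mul]

theorem memLp_comp_smul {n : ℕ} {F : Type*} [NormedAddCommGroup F] {h : Rn n → F}
    (hc : Continuous h) (hh : MemLp h 2) {t : ℝ} (ht : 0 < t) :
    MemLp (fun x => h (t • x)) 2 := by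
  have hc' : Continuous fun x => h (t • x) := hc.comp (continuous_const_smul t)
  rw [memLp_two_iff_integrable_sq_norm hc'.aestronglyMeasurable]
  rw [memLp_two_iff_integrable_sq_norm hc.aestronglyMeasurable] at hh
  exact (integrable_comp_smul_iff volume (fun x => ‖h x‖ ^ 2) ht.ne').2 hh

theorem IsBddH1.comp_smul {n : ℕ} {u : Rn n → ℝ} (hu : IsBddH1 u) {t : ℝ} (ht : 0 < t) :
    IsBddH1 fun x => u (t • x) where
  contDiff := hu.contDiff.comp (contDiff_const_smul t)
  bounded := by
    obtain ⟨M, hM⟩ := hu.bounded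
    exact ⟨M, fun x => hM _⟩
  memLp := memLp_comp_smul hu.contDiff.continuous hu.memLp ht
  memLp_grad := by
    rw [gradient_comp_smul hu.contDiff]
    exact (memLp_comp_smul (continuous_gradient hu.contDiff) hu.memLp_grad ht).const_smul t

theorem dirichlet_comp_smul {n : ℕ} {u : Rn n → ℝ} (hu : IsBddH1 u) {t : ℝ} (ht : 0 < t) :
    dirichlet (fun x => u (t • x)) = (t ^ n)⁻¹ * t ^ 2 * dirichlet u := by
  rw [dirichlet, gradient_comp_smul hu.contDiff,
    integral_comp_smul' (fun x => ‖t • ∇ u x‖ ^ 2) ht]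
  simp only [norm_smul, mul_pow, Real.norm_eq_abs, sq_abs]
  rw [integral_const_mul, dirichlet]
  ring

/-- The numerical source of scale invariance: this exponent makes the dilation factors of the
Dirichlet integral and of the constraint cancel. -/
theorem rpow_pow_eq {n : ℕ} {θ t : ℝ} (hθ : θ * n = n - 2) (ht : 0 < t) :
    (t ^ n) ^ θ = t ^ n / t ^ 2 := by
  rw [← Real.rpow_natCast, ← Real.rpow_mul ht.le, mul_comm (n : ℝ), hθ, Real.rpow_sub ht]
  simp

theorem IsQuotientMin.comp_smul {n : ℕ} {g : ℝ → ℝ} {θ t : ℝ} (hθ : θ * n = n - 2) (ht : 0 < t)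
    {φ : Rn n → ℝ} (h : IsQuotientMin g θ φ) : IsQuotientMin g θ fun x => φ (t • x) where
  isBddH1 := h.isBddH1.comp_smul ht
  pos := by
    rw [integral_comp_smul' (fun x => g (φ x)) ht]
    have := h.pos
    positivity
  le u hu hW := by
    refine le_of_eq_of_le ?_ (h.le u hu hW)
    have hp := h.pos
    rw [dirichlet_comp_smul h.isBddH1 ht, integral_comp_smul' (fun x => g (φ x)) ht]
    rw [show (∫ x, g (u x)) / ((t ^ n)⁻¹ * ∫ x, g (φ x)) =
      t ^ n * ((∫ x, g (u x)) / ∫ x, g (φ x)) by field_simp,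
      Real.mul_rpow (by positivity) (by positivity), rpow_pow_eq hθ ht]
    field_simp

/-! ### Weak gradients of `C¹` functions -/

theorem integral_inner_gradient_eq {n : ℕ} {u ψ : Rn n → ℝ} (hu : ContDiff ℝ 1 u)
    (hψ : ContDiff ℝ 1 ψ) (hc : HasCompactSupport ψ) (v : Rn n) :
    ∫ x, u x * fderiv ℝ ψ x v = - ∫ x, fderiv ℝ u x v * ψ x := by
  have c1 : Continuous fun x => fderiv ℝ u x v := (hu.continuous_fderiv one_ne_zero).clm_apply
    continuous_const
  have c2 : Continuous fun x => fderiv ℝ ψ x v := (hψ.continuous_fderiv one_ne_zero).clm_apply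
    continuous_const
  have s2 : HasCompactSupport fun x => fderiv ℝ ψ x v := hc.fderiv_apply ℝ v
  exact integral_mul_fderiv_eq_neg_fderiv_mul_of_integrable
    ((c1.mul hψ.continuous).integrable_of_hasCompactSupport hc.mul_left)
    ((hu.continuous.mul c2).integrable_of_hasCompactSupport s2.mul_left)
    ((hu.continuous.mul hψ.continuous).integrable_of_hasCompactSupport hc.mul_left)
    (fun x _ => hu.differentiable one_ne_zero x) (fun x _ => hψ.differentiable one_ne_zero x)

theorem hasWeakGradient_of_contDiff {n : ℕ} {u : Rn n → ℝ} (hu : ContDiff ℝ 1 u) :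
    HasWeakGradient u (∇ u) :=
  ⟨hu.continuous.locallyIntegrable, (continuous_gradient hu).locallyIntegrable,
    fun ψ hψ hc v => by
      simp only [inner_gradient]
      exact integral_inner_gradient_eq hu (hψ.of_le (by exact_mod_cast le_top)) hc v⟩

/-- The fundamental lemma of the calculus of variations; it replaces the weak gradient supplied with
the minimizer by the classical one. -/
theorem HasWeakGradient.ae_eq {n : ℕ} {u : Rn n → ℝ} {g g' : Rn n → Rn n}
    (h : HasWeakGradient u g) (h' : HasWeakGradient u g') : g =ᵐ[volume] g' := by
  have hz : ∀ᵐ x, g x - g' x = 0 := by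
    refine ae_eq_zero_of_integral_contDiff_smul_eq_zero (h.2.1.sub h'.2.1) fun ψ hψ hc => ?_
    have i1 := h.2.1.integrable_smul_left_of_hasCompactSupport hψ.continuous hc
    have i2 := h'.2.1.integrable_smul_left_of_hasCompactSupport hψ.continuous hc
    have e1 : ∫ x, ψ x • (g x - g' x) = (∫ x, ψ x • g x) - ∫ x, ψ x • g' x := by
      simp only [smul_sub]
      exact integral_sub i1 i2
    rw [e1, sub_eq_zero]
    refine ext_inner_left ℝ fun v => ?_
    rw [← integral_inner i1, ← integral_inner i2]
    have := (h.2.2 ψ hψ hc v).symm.trans (h'.2.2 ψ hψ hc v)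
    rw [neg_inj] at this
    simpa only [inner_smul_right, real_inner_comm, mul_comm] using this
  filter_upwards [hz] with x hx using sub_eq_zero.1 hx

/-! ### Radial functions -/

/-- In polar coordinates the weight `r^(n-1)` is at least one for `r ≥ 1`, so the profile `v` and
`v'` are square integrable on `(1,∞)`, and `(v²)' = 2vv' ≤ v² + v'²` bounds `v` there. On the unit
ball continuity suffices. This brings the minimizer into the bounded test class. -/
theorem exists_bound_of_radial {n : ℕ} (hn : 1 ≤ n) {w : Rn n → ℝ} (hw : ContDiff ℝ 1 w)
    (hrad : ∀ x y, ‖x‖ = ‖y‖ → w x = w y) (hL : MemLp w 2) (hL' : MemLp (∇ w) 2) :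
    ∃ M, ∀ x, |w x| ≤ M := by
  have : Nonempty (Fin n) := ⟨⟨0, hn⟩⟩
  have : Nontrivial (Rn n) := by
    refine ⟨⟨EuclideanSpace.single ⟨0, hn⟩ 1, 0, fun h => ?_⟩⟩
    have := congrArg norm h
    simp at this
  obtain ⟨e, he⟩ := exists_norm_eq (Rn n) (zero_le_one (α := ℝ))
  set v : ℝ → ℝ := fun r => w (r • e) with hv
  set v' : ℝ → ℝ := fun r => fderiv ℝ w (r • e) e with hv'
  have hwv : ∀ x, w x = v ‖x‖ := fun x => hrad _ _ (by simp [norm_smul, he])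
  have hderiv : ∀ (e' : Rn n) r, HasDerivAt (fun r : ℝ => w (r • e')) (fderiv ℝ w (r • e') e') r := by
    intro e' r
    have h1 : HasDerivAt (fun r : ℝ => r • e') e' r := by
      simpa using (hasDerivAt_id r).smul_const e'
    exact (hw.differentiable one_ne_zero _).hasFDerivAt.comp_hasDerivAt r h1
  -- The profile is the same along every ray, so `v'` may be computed along the ray through `x`,
  -- where it is a directional derivative at `x` itself.
  have hv'le : ∀ x, |v' ‖x‖| ≤ ‖∇ w x‖ := fun x => by
    obtain ⟨e', he', hx⟩ : ∃ e' : Rn n, ‖e'‖ = 1 ∧ ‖x‖ • e' = x := by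
      by_cases h0 : x = 0
      · exact ⟨e, he, by simp [h0]⟩
      · exact ⟨‖x‖⁻¹ • x, by simp [norm_smul, h0], by simp [smul_smul, h0]⟩
    have h1 := hderiv e' ‖x‖
    have h2 : (fun r : ℝ => w (r • e')) = v := by
      ext r; exact hrad _ _ (by simp [norm_smul, he, he'])
    rw [h2] at h1
    have h3 : v' ‖x‖ = fderiv ℝ w x e' := by
      have h4 : v' ‖x‖ = fderiv ℝ w (‖x‖ • e') e' := (hderiv e ‖x‖).unique h1
      rw [h4, hx]
    rw [h3, norm_gradient]
    simpa [he'] using (fderiv ℝ w x).le_opNorm e'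
  have cv : Continuous v := hw.continuous.comp (continuous_id.smul continuous_const)
  have cv' : Continuous v' := ((hw.continuous_fderiv one_ne_zero).comp
    (continuous_id.smul continuous_const)).clm_apply continuous_const
  have ck : Continuous fun r => v r ^ 2 + v' r ^ 2 := (cv.pow 2).add (cv'.pow 2)
  have ik : Integrable fun x : Rn n => (fun r => v r ^ 2 + v' r ^ 2) ‖x‖ := by
    have i1 : Integrable fun x => w x ^ 2 := hL.integrable_sq
    have i2 : Integrable fun x => ‖∇ w x‖ ^ 2 := hL'.integrable_norm_pow two_ne_zero
    refine (i1.add i2).mono' (ck.comp continuous_norm).aestronglyMeasurable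
      (Eventually.of_forall fun x => ?_)
    rw [Real.norm_of_nonneg (by positivity)]
    change v ‖x‖ ^ 2 + v' ‖x‖ ^ 2 ≤ w x ^ 2 + ‖∇ w x‖ ^ 2
    rw [← hwv]
    refine add_le_add le_rfl (sq_le_sq' ?_ (le_of_abs_le (hv'le x)))
    linarith [neg_le_of_abs_le (hv'le x)]
  replace ik := (integrable_fun_norm_addHaar (f := fun r => v r ^ 2 + v' r ^ 2) volume).1 ik
  have ik1 : IntegrableOn (fun r => v r ^ 2 + v' r ^ 2) (Set.Ioi 1) := by
    refine (ik.mono_set (Set.Ioi_subset_Ioi zero_le_one)).mono' ck.aestronglyMeasurable ?_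
    rw [ae_restrict_iff' measurableSet_Ioi]
    refine Eventually.of_forall fun r hr => ?_
    rw [Real.norm_of_nonneg (by positivity), smul_eq_mul]
    exact le_mul_of_one_le_left (by positivity) (one_le_pow₀ (le_of_lt hr))
  set K := ∫ r in Set.Ioi 1, v r ^ 2 + v' r ^ 2 with hK
  have hbig : ∀ r, 1 ≤ r → v r ^ 2 ≤ v 1 ^ 2 + K := fun r hr => by
    have h1 : ∫ s in (1 : ℝ)..r, 2 * v s * v' s = v r ^ 2 - v 1 ^ 2 := by
      refine intervalIntegral.integral_eq_sub_of_hasDerivAt (f := fun s => v s ^ 2)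
        (fun s _ => ?_) ?_
      · refine ((hderiv e s).pow 2).congr_deriv ?_
        simp [hv, hv']
      · exact ((continuous_const.mul cv).mul cv').intervalIntegrable _ _
    have h2 : ∫ s in (1 : ℝ)..r, 2 * v s * v' s ≤ ∫ s in (1 : ℝ)..r, v s ^ 2 + v' s ^ 2 := by
      refine intervalIntegral.integral_mono_on hr
        (((continuous_const.mul cv).mul cv').intervalIntegrable _ _) (ck.intervalIntegrable _ _)
        fun s _ => ?_
      nlinarith [sq_nonneg (v s - v' s)]
    have h3 : ∫ s in (1 : ℝ)..r, v s ^ 2 + v' s ^ 2 ≤ K := by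
      rw [intervalIntegral.integral_of_le hr]
      exact setIntegral_mono_set ik1 (Eventually.of_forall fun s => by simp only [Pi.zero_apply]; positivity)
        (Eventually.of_forall fun s hs => hs.1)
    linarith
  obtain ⟨M₁, hM₁⟩ := (isCompact_Icc (a := (0 : ℝ)) (b := 1)).exists_bound_of_continuousOn
    cv.continuousOn
  refine ⟨max M₁ √(v 1 ^ 2 + K), fun x => ?_⟩
  rw [hwv]
  rcases le_total ‖x‖ 1 with hx | hx
  · exact (hM₁ _ ⟨norm_nonneg x, hx⟩).trans (le_max_left _ _)
  · exact (Real.abs_le_sqrt (hbig _ hx)).trans (le_max_right _ _)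

/-! ### The constrained minimizer -/

theorem IsBddH1.isAdmissible {n : ℕ} {β : ℝ → ℝ} {α : ℝ} {f f' : ℝ → ℝ}
    (hg : IsPotential (G β α) f f') {u : Rn n → ℝ} (hu : IsBddH1 u)
    (h1 : ∫ x, G β α (u x) = 1) : IsAdmissible β α u (∇ u) where
  memLp := hu.memLp
  memLp_grad := hu.memLp_grad
  weakGradient := hasWeakGradient_of_contDiff hu.contDiff
  integrable := hg.integrable_comp hu
  constraint := h1

/-- A competitor `u` with `W[u] > 0` becomes admissible after dilation by `t = W[u]^(1/n)`, and the
power of `t` gained by the Dirichlet integral is exactly `W[u]^θ`. -/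
theorem IsConstrainedMinimizer.isQuotientMin {n : ℕ} (hn : 1 ≤ n) {β : ℝ → ℝ} {α θ : ℝ}
    (hθ : θ * n = n - 2) {f f' : ℝ → ℝ} (hg : IsPotential (G β α) f f') {w : Rn n → ℝ}
    (hw : IsConstrainedMinimizer β α w) (hC : ContDiff ℝ 1 w)
    (hrad : ∀ x y, ‖x‖ = ‖y‖ → w x = w y) : IsQuotientMin (G β α) θ w := by
  obtain ⟨d, hd, hmin⟩ := hw
  have hae : d =ᵐ[volume] ∇ w := hd.weakGradient.ae_eq (hasWeakGradient_of_contDiff hC)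
  have hL' : MemLp (∇ w) 2 := hd.memLp_grad.ae_eq hae
  refine ⟨⟨hC, exists_bound_of_radial hn hC hrad hd.memLp hL', hd.memLp, hL'⟩,
    by rw [hd.constraint]; exact one_pos, fun u hu hW => ?_⟩
  set t : ℝ := (∫ x, G β α (u x)) ^ ((n : ℝ)⁻¹) with ht
  have ht0 : 0 < t := Real.rpow_pos_of_pos hW _
  have htn : t ^ n = ∫ x, G β α (u x) := Real.rpow_inv_natCast_pow hW.le (by omega)
  have hut := hu.comp_smul ht0
  have h1 : ∫ x, G β α (u (t • x)) = 1 := by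
    rw [integral_comp_smul' (fun x => G β α (u x)) ht0, htn, inv_mul_cancel₀ hW.ne']
  have h2 := hmin _ _ (hut.isAdmissible hg h1)
  have h3 : ∫ x, ‖d x‖ ^ 2 = dirichlet w :=
    integral_congr_ae (hae.mono fun x hx => by simp only [hx])
  change _ ≤ dirichlet _ at h2
  rw [h3, dirichlet_comp_smul hu ht0] at h2
  rw [hd.constraint, div_one, ← htn, rpow_pow_eq hθ ht0]
  calc dirichlet w * (t ^ n / t ^ 2) ≤ ((t ^ n)⁻¹ * t ^ 2 * dirichlet u) * (t ^ n / t ^ 2) := by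
        gcongr
    _ = dirichlet u := by field_simp

/-! ### Integration by parts and the Lagrange multiplier -/

theorem inner_gradient_eq_sum {n : ℕ} (u v : Rn n → ℝ) (x : Rn n) :
    inner ℝ (∇ u x) (∇ v x) = ∑ i, fderiv ℝ u x (EuclideanSpace.basisFun (Fin n) ℝ i) *
      fderiv ℝ v x (EuclideanSpace.basisFun (Fin n) ℝ i) := by
  rw [← (EuclideanSpace.basisFun (Fin n) ℝ).sum_inner_mul_inner]
  refine Finset.sum_congr rfl fun i _ => ?_
  rw [inner_gradient, real_inner_comm, inner_gradient]

theorem contDiff_fderiv_apply {n : ℕ} {u : Rn n → ℝ} (hu : ContDiff ℝ 2 u) (e : Rn n) :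
    ContDiff ℝ 1 fun x => fderiv ℝ u x e :=
  (hu.fderiv_right (m := 1) (by norm_num)).clm_apply contDiff_const

theorem laplacian_eq_sum_fderiv {n : ℕ} {u : Rn n → ℝ} (hu : ContDiff ℝ 2 u) (x : Rn n) :
    Δ u x = ∑ i, fderiv ℝ (fun y => fderiv ℝ u y (EuclideanSpace.basisFun (Fin n) ℝ i)) x
      (EuclideanSpace.basisFun (Fin n) ℝ i) := by
  rw [InnerProductSpace.laplacian_eq_iteratedFDeriv_orthonormalBasis u
    (EuclideanSpace.basisFun (Fin n) ℝ)]
  refine Finset.sum_congr rfl fun i _ => ?_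
  have h : DifferentiableAt ℝ (fderiv ℝ u) x :=
    (hu.fderiv_right (m := 1) (by norm_num)).differentiable one_ne_zero x
  rw [iteratedFDeriv_two_apply, fderiv_clm_apply h (differentiableAt_const _)]
  simp

theorem continuous_laplacian {n : ℕ} {u : Rn n → ℝ} (hu : ContDiff ℝ 2 u) : Continuous (Δ u) := by
  have : Δ u = fun x => ∑ i, fderiv ℝ (fun y => fderiv ℝ u y
      (EuclideanSpace.basisFun (Fin n) ℝ i)) x (EuclideanSpace.basisFun (Fin n) ℝ i) :=
    funext fun x => laplacian_eq_sum_fderiv hu x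
  rw [this]
  exact continuous_finsetSum _ fun i _ =>
    ((contDiff_fderiv_apply hu _).continuous_fderiv one_ne_zero).clm_apply continuous_const

theorem integral_inner_gradient_eq_laplacian {n : ℕ} {u ψ : Rn n → ℝ} (hu : ContDiff ℝ 2 u)
    (hψ : ContDiff ℝ 1 ψ) (hc : HasCompactSupport ψ) :
    ∫ x, inner ℝ (∇ u x) (∇ ψ x) = - ∫ x, Δ u x * ψ x := by
  simp only [inner_gradient_eq_sum, laplacian_eq_sum_fderiv hu, Finset.sum_mul]
  rw [integral_finsetSum, integral_finsetSum, ← Finset.sum_neg_distrib]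
  · exact Finset.sum_congr rfl fun i _ =>
      integral_inner_gradient_eq (contDiff_fderiv_apply hu _) hψ hc _
  · exact fun i _ => ((((contDiff_fderiv_apply hu _).continuous_fderiv one_ne_zero).clm_apply
      continuous_const).mul hψ.continuous).integrable_of_hasCompactSupport hc.mul_left
  · exact fun i _ => ((contDiff_fderiv_apply hu _).continuous.mul
      ((hψ.continuous_fderiv one_ne_zero).clm_apply
      continuous_const)).integrable_of_hasCompactSupport (hc.fderiv_apply ℝ _).mul_left

/-- The Lagrange multiplier is determined by the Dirichlet integral and the constraint. -/
theorem IsQuotientMin.multiplier {n : ℕ} [Nontrivial (Rn n)] {g f f' : ℝ → ℝ} {θ lam : ℝ} {w : Rn n → ℝ}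
    (h : IsQuotientMin g θ w) (hg : IsPotential g f f') (hC : ContDiff ℝ 2 w)
    (hEL : ∀ x, -(1 / 2) * Δ w x - lam * f (w x) = 0) :
    4 * lam = dirichlet w * θ / ∫ x, g (w x) := by
  set μ := dirichlet w * θ / ∫ x, g (w x) with hμ
  have hC1 : ContDiff ℝ 1 w := hC.of_le (by norm_num)
  have hfc : Continuous fun x => f (w x) := hg.continuous_deriv.comp hC1.continuous
  -- If the two multipliers differed, subtracting the two Euler–Lagrange equations would give `f ∘ w
  -- = 0`. Then `g ∘ w` is constant and integrable over a space of infinite measure, hence zero,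
  -- against positivity of its integral.
  by_contra hne
  have hz : ∀ᵐ x : Rn n, f (w x) = 0 := by
    refine ae_eq_zero_of_integral_contDiff_smul_eq_zero hfc.locallyIntegrable fun ψ hψ hc => ?_
    have hψ1 : ContDiff ℝ 1 ψ := hψ.of_le (by exact_mod_cast le_top)
    have h1 := (h.variation hg (IsBddH1.of_hasCompactSupport hψ1 hc) hμ).1
    rw [integral_inner_gradient_eq_laplacian hC hψ1 hc] at h1
    have h2 : ∀ x, Δ w x * ψ x = -(2 * lam) * (f (w x) * ψ x) := fun x => by
      linear_combination (-2 * ψ x) * hEL x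
    simp only [h2, integral_const_mul] at h1
    simp only [smul_eq_mul, mul_comm (ψ _)]
    have h3 : (4 * lam - μ) * ∫ x, f (w x) * ψ x = 0 := by linear_combination h1
    exact (mul_eq_zero.1 h3).resolve_left (sub_ne_zero.2 hne)
  have hz' : (fun x => f (w x)) = fun _ => 0 :=
    hfc.ae_eq_iff_eq volume continuous_const |>.1 hz
  have hconst : ∀ x, g (w x) = g (w 0) := fun x => by
    refine is_const_of_fderiv_eq_zero (f := fun x => g (w x)) (𝕜 := ℝ) (fun x => ?_) (fun x => ?_) x 0
    · exact (hg.hasDerivAt _).differentiableAt.comp x (hC1.differentiable one_ne_zero x)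
    · have h1 := (hg.hasDerivAt (w x)).comp_hasFDerivAt x
        (hC1.differentiable one_ne_zero x).hasFDerivAt
      rw [congrFun hz' x, zero_smul] at h1
      exact h1.fderiv
  have hi := hg.integrable_comp h.isBddH1
  have hp := h.pos
  simp only [hconst] at hi hp
  rcases (integrable_const_iff (c := g (w 0))).1 hi with h0 | h0
  · simp [h0] at hp
  · have : NoncompactSpace (Rn n) := NormedSpace.noncompactSpace ℝ (Rn n)
    exact absurd h0.measure_univ_lt_top (by simp [measure_univ_of_isAddLeftInvariant])

theorem IsQuotientMin.dirichlet_pos {n : ℕ} [Nontrivial (Rn n)] {g f f' : ℝ → ℝ} {θ : ℝ}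
    {w : Rn n → ℝ} (h : IsQuotientMin g θ w) (hg : IsPotential g f f') : 0 < dirichlet w := by
  have hw := h.isBddH1
  have hi : Integrable fun x => ‖∇ w x‖ ^ 2 := hw.memLp_grad.integrable_norm_pow two_ne_zero
  refine lt_of_le_of_ne (integral_nonneg fun x => sq_nonneg _) fun h0 => ?_
  have h1 := (integral_eq_zero_iff_of_nonneg (fun x => sq_nonneg _) hi).1 h0.symm
  have h2 : (fun x => ‖∇ w x‖ ^ 2) = 0 :=
    ((continuous_gradient hw.contDiff).norm.pow 2).ae_eq_iff_eq volume continuous_const |>.1 h1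
  have hconst : ∀ x, w x = w 0 := fun x => by
    refine is_const_of_fderiv_eq_zero (𝕜 := ℝ) (hw.contDiff.differentiable one_ne_zero)
      (fun x => ?_) x 0
    have := congrFun h2 x
    simpa [norm_gradient] using this
  have hp := h.pos
  have hL := hw.memLp.integrable_sq
  simp only [hconst] at hp hL
  rcases integrable_const_iff.1 hL with h0 | h0
  · have : w 0 = 0 := by simpa using h0
    simp [this, hg.zero] at hp
  · have : NoncompactSpace (Rn n) := NormedSpace.noncompactSpace ℝ (Rn n)
    exact absurd h0.measure_univ_lt_top (by simp [measure_univ_of_isAddLeftInvariant])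

theorem laplacian_comp_smul {n : ℕ} {u : Rn n → ℝ} (hu : ContDiff ℝ 2 u) (t : ℝ) (x : Rn n) :
    Δ (fun x => u (t • x)) x = t ^ 2 * Δ u (t • x) := by
  have key : ∀ {v : Rn n → ℝ}, ContDiff ℝ 1 v → ∀ y e,
      fderiv ℝ (fun x => v (t • x)) y e = t * fderiv ℝ v (t • y) e := fun {v} hv y e => by
    have h1 : HasFDerivAt (fun x : Rn n => t • x) (t • ContinuousLinearMap.id ℝ (Rn n)) y :=
      (hasFDerivAt_id y).const_smul t
    have h2 := ((hv.differentiable one_ne_zero (t • y)).hasFDerivAt).comp y h1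
    have h3 := congrArg (fun L => L e) h2.fderiv
    simpa [Function.comp_def] using h3
  have hu1 : ContDiff ℝ 1 u := hu.of_le (by norm_num)
  rw [laplacian_eq_sum_fderiv (u := fun x => u (t • x)) (hu.comp (contDiff_const_smul t)),
    laplacian_eq_sum_fderiv hu,
    Finset.mul_sum]
  refine Finset.sum_congr rfl fun i _ => ?_
  set e := EuclideanSpace.basisFun (Fin n) ℝ i
  have h1 : (fun y => fderiv ℝ (fun x => u (t • x)) y e) =
      fun y => t * fderiv ℝ u (t • y) e := funext fun y => key hu1 y e
  have hc := contDiff_fderiv_apply hu e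
  have h2 : fderiv ℝ (fun y => t * fderiv ℝ u (t • y) e) x =
      t • fderiv ℝ (fun y => fderiv ℝ u (t • y) e) x :=
    fderiv_const_mul ((hc.comp (contDiff_const_smul t)).differentiable one_ne_zero x) t
  rw [h1, h2, smul_apply, key hc, smul_eq_mul]
  ring

/-! ### The generator of dilations as a negative direction -/

theorem hasCompactSupport_sq {X : Type*} [TopologicalSpace X] {h : X → ℝ}
    (hc : HasCompactSupport h) : HasCompactSupport fun x => h x ^ 2 :=
  hc.comp_left (g := fun s : ℝ => s ^ 2) (by simp)

theorem hasCompactSupport_gradient {n : ℕ} {u : Rn n → ℝ} (hc : HasCompactSupport u) :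
    HasCompactSupport (∇ u) :=
  (hc.fderiv ℝ).comp_left (map_zero (InnerProductSpace.toDual ℝ (Rn n)).symm)

theorem hasCompactSupport_norm_gradient_sq {n : ℕ} {u : Rn n → ℝ} (hc : HasCompactSupport u) :
    HasCompactSupport fun x => ‖∇ u x‖ ^ 2 :=
  hasCompactSupport_sq (hasCompactSupport_gradient hc).norm

/-- Pointwise `|∇(ηu)|² = |∇η|² u² + ∇u · ∇(η²u)`; the last term is then integrated by parts, so
only `u` needs two derivatives. -/
theorem dirichlet_mul_eq {n : ℕ} {η u : Rn n → ℝ} (hη : ContDiff ℝ 1 η) (hc : HasCompactSupport η)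
    (hu : ContDiff ℝ 2 u) :
    dirichlet (fun x => η x * u x) = ∫ x, (‖∇ η x‖ ^ 2 * u x ^ 2 - Δ u x * (η x ^ 2 * u x)) := by
  have hu1 : ContDiff ℝ 1 u := hu.of_le (by norm_num)
  have hη2 : ContDiff ℝ 1 fun x => η x * η x := hη.mul hη
  have hηu : ContDiff ℝ 1 fun x => η x * η x * u x := hη2.mul hu1
  have hc2 : HasCompactSupport fun x => η x * η x * u x := (hc.mul_right).mul_right
  have hgc := hasCompactSupport_norm_gradient_sq hc
  have h1 : ∀ x, ‖∇ (fun x => η x * u x) x‖ ^ 2 = ‖∇ η x‖ ^ 2 * u x ^ 2 +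
      inner ℝ (∇ u x) (∇ (fun x => η x * η x * u x) x) := fun x => by
    rw [gradient_mul' hη2 hu1, gradient_mul' hη hu1, gradient_mul' hη hη]
    simp only [norm_add_sq_real, norm_smul, inner_smul_left, inner_smul_right, inner_add_right,
      real_inner_self_eq_norm_sq, real_inner_comm, mul_pow, Real.norm_eq_abs, sq_abs]
    simp only [conj_trivial]
    rw [real_inner_comm (∇ u x) (∇ η x)]
    ring
  have i1 : Integrable fun x => ‖∇ η x‖ ^ 2 * u x ^ 2 :=
    (((continuous_gradient hη).norm.pow 2).mul (hu1.continuous.pow 2)).integrable_of_hasCompactSupport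
      hgc.mul_right
  have i2 : Integrable fun x => inner ℝ (∇ u x) (∇ (fun x => η x * η x * u x) x) := by
    refine ((continuous_gradient hu1).inner (continuous_gradient hηu)).integrable_of_hasCompactSupport
      ?_
    refine (hasCompactSupport_gradient hc2).mono fun x hx => ?_
    contrapose! hx
    rw [Function.notMem_support] at hx ⊢
    rw [hx, inner_zero_right]
  have i3 : Integrable fun x => Δ u x * (η x ^ 2 * u x) :=
    ((continuous_laplacian hu).mul ((hη.continuous.pow 2).mul
      hu1.continuous)).integrable_of_hasCompactSupport
        (HasCompactSupport.mul_left (hasCompactSupport_sq hc).mul_right)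
  simp only [dirichlet, h1]
  rw [integral_add i1 i2, integral_inner_gradient_eq_laplacian hu hηu hc2, integral_sub i1 i3]
  simp only [pow_two, sub_eq_add_neg]

/-- Supplies the dominating constants when the difference quotients in the dilation parameter
converge. -/
theorem exists_bound_slope {X : Type*} [TopologicalSpace X] {P P' : ℝ → X → ℝ}
    (hP : ∀ t x, HasDerivAt (fun t => P t x) (P' t x) t)
    (hc : Continuous fun q : ℝ × X => P' q.1 q.2) {K : Set X} (hK : IsCompact K) :
    ∃ C, ∀ x ∈ K, ∀ t ∈ Set.Icc (0 : ℝ) 2, |slope (fun t => P t x) 1 t| ≤ C := by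
  obtain ⟨C, hC⟩ := ((isCompact_Icc (a := (0 : ℝ)) (b := 2)).prod hK).exists_bound_of_continuousOn
    hc.continuousOn
  refine ⟨max C 0, fun x hx t ht => ?_⟩
  have h := (convex_Icc (0 : ℝ) 2).norm_image_sub_le_of_norm_hasDerivWithin_le
    (f := fun t => P t x) (f' := fun t => P' t x) (C := max C 0)
    (fun s _ => (hP s x).hasDerivWithinAt)
    (fun s hs => (hC (s, x) ⟨hs, hx⟩).trans (le_max_left _ _))
    (show (1 : ℝ) ∈ Set.Icc (0 : ℝ) 2 by norm_num) ht
  rw [slope_def_field, abs_div]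
  exact div_le_of_le_mul₀ (abs_nonneg _) (le_max_right _ _) h

/-- If the second variation at a solution `φ` is nonnegative, then testing it with the generator
of dilations, cut off by `η`, gives a nonnegative number. -/
theorem dilation_nonneg {n : ℕ} {g f f' : ℝ → ℝ} (hg : IsPotential g f f') {φ : Rn n → ℝ}
    (hφ : ContDiff ℝ 2 φ) (hEq : ∀ x, Δ φ x = -2 * f (φ x))
    (hQ : ∀ ψ : Rn n → ℝ, ContDiff ℝ 1 ψ → HasCompactSupport ψ →
      0 ≤ dirichlet ψ / 2 - ∫ x, f' (φ x) * ψ x ^ 2)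
    {η : Rn n → ℝ} (hη : ContDiff ℝ 1 η) (hc : HasCompactSupport η) :
    0 ≤ ∫ x, (‖∇ η x‖ ^ 2 * fderiv ℝ φ x x ^ 2 / 2 + 2 * f (φ x) * fderiv ℝ φ x x * η x ^ 2) := by
  have hφ1 : ContDiff ℝ 1 φ := hφ.of_le (by norm_num)
  have dφ : ∀ t x, HasDerivAt (fun t : ℝ => φ (t • x)) (fderiv ℝ φ (t • x) x) t := fun t x => by
    have h1 : HasDerivAt (fun r : ℝ => r • x) x t := by
      simpa using (hasDerivAt_id t).smul_const x
    exact (hφ1.differentiable one_ne_zero _).hasFDerivAt.comp_hasDerivAt t h1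
  have dN : ∀ t x, HasDerivAt (fun t : ℝ => t ^ 2 * f (φ (t • x)))
      (2 * t * f (φ (t • x)) + t ^ 2 * (f' (φ (t • x)) * fderiv ℝ φ (t • x) x)) t := fun t x => by
    have h1 := (hg.hasDerivAt' (φ (t • x))).comp t (dφ t x)
    refine ((hasDerivAt_pow 2 t).mul h1).congr_deriv ?_
    simp
  have csm : Continuous fun q : ℝ × Rn n => φ (q.1 • q.2) :=
    hφ1.continuous.comp (continuous_fst.smul continuous_snd)
  have cdφ : Continuous fun q : ℝ × Rn n => fderiv ℝ φ (q.1 • q.2) q.2 :=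
    ((hφ1.continuous_fderiv one_ne_zero).comp (continuous_fst.smul continuous_snd)).clm_apply
      continuous_snd
  have cN : Continuous fun q : ℝ × Rn n => 2 * q.1 * f (φ (q.1 • q.2)) +
      q.1 ^ 2 * (f' (φ (q.1 • q.2)) * fderiv ℝ φ (q.1 • q.2) q.2) :=
    ((continuous_const.mul continuous_fst).mul (hg.continuous_deriv.comp csm)).add
      ((continuous_fst.pow 2).mul ((hg.continuous'.comp csm).mul cdφ))
  obtain ⟨C₁, hC₁⟩ := exists_bound_slope dφ cdφ hc.isCompact
  obtain ⟨C₂, hC₂⟩ := exists_bound_slope dN cN hc.isCompact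
  -- `x·∇φ` is only `C¹`, so the localization identity does not apply to it. The difference `φ(t•x)
  -- - φ(x)` is `C²`, and its Laplacian is known from the equation; `D` and `N` are the resulting
  -- quotients.
  set D : ℝ → Rn n → ℝ := fun t x => slope (fun t : ℝ => φ (t • x)) 1 t with hD
  set N : ℝ → Rn n → ℝ := fun t x => slope (fun t : ℝ => t ^ 2 * f (φ (t • x))) 1 t with hN
  set I : ℝ → Rn n → ℝ := fun t x => ‖∇ η x‖ ^ 2 * D t x ^ 2 / 2 + N t x * D t x * η x ^ 2
    - f' (φ x) * D t x ^ 2 * η x ^ 2 with hI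
  have cφt : ∀ t : ℝ, Continuous fun x => φ (t • x) := fun t =>
    hφ1.continuous.comp (continuous_const_smul t)
  have cD : ∀ t, Continuous (D t) := fun t => by
    simp only [hD, slope_def_field]
    exact ((cφt t).sub (cφt 1)).div_const _
  have cNt : ∀ t, Continuous (N t) := fun t => by
    simp only [hN, slope_def_field]
    exact ((continuous_const.mul (hg.continuous_deriv.comp (cφt t))).sub
      (continuous_const.mul (hg.continuous_deriv.comp (cφt 1)))).div_const _
  have cη := hη.continuous
  have cgη := continuous_gradient hη
  have cf' : Continuous fun x => f' (φ x) := hg.continuous'.comp hφ1.continuous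
  have hgc := hasCompactSupport_norm_gradient_sq hc
  have hc2 := hasCompactSupport_sq hc
  have hpos : ∀ t, t ≠ 1 → 0 ≤ ∫ x, I t x := fun t ht => by
    have hu : ContDiff ℝ 2 fun x => φ (t • x) - φ x :=
      (hφ.comp (contDiff_const_smul t)).sub hφ
    have h1 := hQ (fun x => η x * (φ (t • x) - φ x)) (hη.mul (hu.of_le (by norm_num))) hc.mul_right
    rw [dirichlet_mul_eq hη hc hu] at h1
    have hΔ : ∀ x, Δ (fun x => φ (t • x) - φ x) x = -2 * (t ^ 2 * f (φ (t • x)) - f (φ x)) :=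
      fun x => by
        have h2 := ContDiffAt.laplacian_sub (f₁ := fun x => φ (t • x)) (f₂ := φ) (x := x)
          (hφ.comp (contDiff_const_smul t)).contDiffAt hφ.contDiffAt
        rw [laplacian_comp_smul hφ, hEq, hEq] at h2
        refine Eq.trans h2 ?_
        ring
    simp only [hΔ] at h1
    have i1 : Integrable fun x => ‖∇ η x‖ ^ 2 * (φ (t • x) - φ x) ^ 2 -
        -2 * (t ^ 2 * f (φ (t • x)) - f (φ x)) * (η x ^ 2 * (φ (t • x) - φ x)) := by
      refine Continuous.integrable_of_hasCompactSupport ?_ ?_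
      · have c0 : Continuous fun x => φ (t • x) - φ x := hu.continuous
        have c1 : Continuous fun x => f (φ (t • x)) := hg.continuous_deriv.comp (cφt t)
        have c2 : Continuous fun x => f (φ x) := hg.continuous_deriv.comp hφ1.continuous
        exact ((cgη.norm.pow 2).mul (c0.pow 2)).sub ((continuous_const.mul
          ((continuous_const.mul c1).sub c2)).mul ((cη.pow 2).mul c0))
      · exact HasCompactSupport.sub hgc.mul_right (HasCompactSupport.mul_left hc2.mul_right)
    have i2 : Integrable fun x => f' (φ x) * (η x * (φ (t • x) - φ x)) ^ 2 := by
      exact (cf'.mul ((cη.mul hu.continuous).pow 2)).integrable_of_hasCompactSupport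
        (HasCompactSupport.mul_left (hasCompactSupport_sq hc.mul_right))
    rw [← integral_div, ← integral_sub (i1.div_const 2) i2] at h1
    have h3 : ∀ x, I t x = ((t - 1) ^ 2)⁻¹ * ((‖∇ η x‖ ^ 2 * (φ (t • x) - φ x) ^ 2 -
        -2 * (t ^ 2 * f (φ (t • x)) - f (φ x)) * (η x ^ 2 * (φ (t • x) - φ x))) / 2
        - f' (φ x) * (η x * (φ (t • x) - φ x)) ^ 2) := fun x => by
      have : t - 1 ≠ 0 := sub_ne_zero.2 ht
      simp only [hI, hD, hN, slope_def_field, one_smul, one_pow, one_mul]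
      field_simp
      ring
    simp only [h3, integral_const_mul]
    exact mul_nonneg (by positivity) h1
  have hlim : Tendsto (fun t => ∫ x, I t x) (𝓝[≠] 1) (𝓝 (∫ x, (‖∇ η x‖ ^ 2 *
      fderiv ℝ φ x x ^ 2 / 2 + 2 * f (φ x) * fderiv ℝ φ x x * η x ^ 2))) := by
    refine tendsto_integral_filter_of_dominated_convergence (fun x => ‖∇ η x‖ ^ 2 * C₁ ^ 2 / 2 +
      C₂ * C₁ * η x ^ 2 + |f' (φ x)| * C₁ ^ 2 * η x ^ 2) ?_ ?_ ?_ ?_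
    · refine Eventually.of_forall fun t => Continuous.aestronglyMeasurable ?_
      exact ((((cgη.norm.pow 2).mul ((cD t).pow 2)).div_const 2).add
        (((cNt t).mul (cD t)).mul (cη.pow 2))).sub ((cf'.mul ((cD t).pow 2)).mul (cη.pow 2))
    · have hev : ∀ᶠ t in 𝓝[≠] (1 : ℝ), t ∈ Set.Icc (0 : ℝ) 2 :=
        nhdsWithin_le_nhds (Icc_mem_nhds (by norm_num) (by norm_num))
      filter_upwards [hev] with t ht
      refine Eventually.of_forall fun x => ?_
      by_cases hx : x ∈ tsupport η
      · have b1 : |D t x| ≤ C₁ := hC₁ x hx t ht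
        have b2 : |N t x| ≤ C₂ := hC₂ x hx t ht
        have b0 : 0 ≤ C₁ := (abs_nonneg _).trans b1
        have b3 : D t x ^ 2 ≤ C₁ ^ 2 := by rw [← sq_abs]; gcongr
        have b4 : |N t x * D t x| ≤ C₂ * C₁ := by
          rw [abs_mul]; exact mul_le_mul b2 b1 (abs_nonneg _) ((abs_nonneg _).trans b2)
        have hη2 := sq_nonneg (η x)
        refine (norm_sub_le _ _).trans (add_le_add ((norm_add_le _ _).trans (add_le_add ?_ ?_)) ?_)
        · rw [Real.norm_of_nonneg (by positivity)]
          gcongr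
        · rw [norm_mul, Real.norm_of_nonneg hη2]
          exact mul_le_mul_of_nonneg_right b4 hη2
        · rw [norm_mul, norm_mul, Real.norm_of_nonneg hη2, Real.norm_of_nonneg (sq_nonneg (D t x)),
            Real.norm_eq_abs]
          gcongr
      · have e1 : η x = 0 := image_eq_zero_of_notMem_tsupport hx
        have e2 : ∇ η x = 0 := by
          rw [gradient, image_eq_zero_of_notMem_tsupport
            (fun h => hx (tsupport_fderiv_subset ℝ h)), map_zero]
        simp [hI, e1, e2]
    · refine Integrable.add (Integrable.add ?_ ?_) ?_
      · simp only [mul_div_assoc]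
        exact ((cgη.norm.pow 2).mul continuous_const).integrable_of_hasCompactSupport hgc.mul_right
      · exact (continuous_const.mul (cη.pow 2)).integrable_of_hasCompactSupport hc2.mul_left
      · exact ((cf'.abs.mul continuous_const).mul (cη.pow 2)).integrable_of_hasCompactSupport
          hc2.mul_left
    · refine Eventually.of_forall fun x => ?_
      have t1 : Tendsto (fun t => D t x) (𝓝[≠] 1) (𝓝 (fderiv ℝ φ x x)) := by
        have := (hasDerivAt_iff_tendsto_slope.1 (dφ 1 x))
        simpa only [one_smul] using this
      -- The part `f'(φ) x·∇φ` of this limit cancels the potential term of `I`, which leaves `2 f(φ)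
      -- x·∇φ`.
      have t2 : Tendsto (fun t => N t x) (𝓝[≠] 1)
          (𝓝 (2 * f (φ x) + f' (φ x) * fderiv ℝ φ x x)) := by
        have := (hasDerivAt_iff_tendsto_slope.1 (dN 1 x))
        simpa only [one_smul, one_pow, one_mul, mul_one] using this
      have t3 := ((((t1.pow 2).const_mul (‖∇ η x‖ ^ 2)).div_const 2).add
        ((t2.mul t1).mul_const (η x ^ 2))).sub (((t1.pow 2).const_mul (f' (φ x))).mul_const (η x ^ 2))
      refine t3.congr' (Eventually.of_forall fun t => ?_) |>.trans (le_of_eq ?_)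
      · simp only [hI]
      · congr 1
        ring
  refine ge_of_tendsto hlim ?_
  filter_upwards [self_mem_nhdsWithin] with t ht using hpos t ht

/-- The divergence of `x ↦ m(x) x` is `n m + x·∇m`; the integration by parts is done one coordinate
at a time. -/
theorem integral_dilation {n : ℕ} {u m : Rn n → ℝ} (hu : ContDiff ℝ 1 u) (hm : ContDiff ℝ 1 m)
    (hc : HasCompactSupport m) :
    ∫ x, fderiv ℝ u x x * m x = - ∫ x, u x * (n * m x + fderiv ℝ m x x) := by
  have hcoord : ∀ i : Fin n, ContDiff ℝ 1 fun x : Rn n => x i := fun i =>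
    (EuclideanSpace.proj (𝕜 := ℝ) i).contDiff
  have hself : ∀ (L : Rn n →L[ℝ] ℝ) (x : Rn n),
      L x = ∑ i, x i * L (EuclideanSpace.basisFun (Fin n) ℝ i) := fun L x => by
    conv_lhs => rw [← (EuclideanSpace.basisFun (Fin n) ℝ).sum_repr x, map_sum]
    simp
  have key : ∀ i : Fin n, ∫ x, u x * (m x + x i * fderiv ℝ m x (EuclideanSpace.basisFun (Fin n) ℝ i))
      = - ∫ x, x i * fderiv ℝ u x (EuclideanSpace.basisFun (Fin n) ℝ i) * m x := fun i => by
    have h1 := integral_inner_gradient_eq hu ((hcoord i).mul hm) hc.mul_left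
      (EuclideanSpace.basisFun (Fin n) ℝ i)
    have h2 : ∀ x, fderiv ℝ (fun x : Rn n => x i * m x) x (EuclideanSpace.basisFun (Fin n) ℝ i) =
        m x + x i * fderiv ℝ m x (EuclideanSpace.basisFun (Fin n) ℝ i) := fun x => by
      have h3 : HasFDerivAt (fun x : Rn n => x i) (EuclideanSpace.proj (𝕜 := ℝ) i) x :=
        (EuclideanSpace.proj (𝕜 := ℝ) i).hasFDerivAt
      have h4 := (h3.mul (hm.differentiable one_ne_zero x).hasFDerivAt).fderiv
      have h5 := congrArg (fun L => L (EuclideanSpace.basisFun (Fin n) ℝ i)) h4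
      refine Eq.trans h5 ?_
      simp
      ring
    simp only [h2] at h1
    rw [h1]
    congr 2
    ext x
    ring
  have cu := hu.continuous
  have cm := hm.continuous
  have cdu : ∀ e, Continuous fun x => fderiv ℝ u x e := fun e =>
    (hu.continuous_fderiv one_ne_zero).clm_apply continuous_const
  have cdm : ∀ e, Continuous fun x => fderiv ℝ m x e := fun e =>
    (hm.continuous_fderiv one_ne_zero).clm_apply continuous_const
  have h1 : ∀ x, fderiv ℝ u x x * m x =
      ∑ i, x i * fderiv ℝ u x (EuclideanSpace.basisFun (Fin n) ℝ i) * m x := fun x => by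
    rw [hself (fderiv ℝ u x) x, Finset.sum_mul]
  have h2 : ∀ x, u x * (n * m x + fderiv ℝ m x x) =
      ∑ i, u x * (m x + x i * fderiv ℝ m x (EuclideanSpace.basisFun (Fin n) ℝ i)) := fun x => by
    rw [hself (fderiv ℝ m x) x, ← Finset.mul_sum, Finset.sum_add_distrib]
    simp
  simp only [h1, h2]
  rw [integral_finsetSum, integral_finsetSum, ← Finset.sum_neg_distrib]
  · exact Finset.sum_congr rfl fun i _ => by rw [key i, neg_neg]
  · exact fun i _ => (cu.mul (cm.add ((hcoord i).continuous.mul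
      (cdm _)))).integrable_of_hasCompactSupport
      (HasCompactSupport.mul_left (hc.add (HasCompactSupport.mul_left (hc.fderiv_apply ℝ _))))
  · exact fun i _ => (((hcoord i).continuous.mul (cdu _)).mul cm).integrable_of_hasCompactSupport
      hc.mul_left

/-- The second variation at a ground state takes a negative value. -/
theorem exists_negative_direction {n : ℕ} (hn : 1 ≤ n) {g f f' : ℝ → ℝ} (hg : IsPotential g f f')
    {φ : Rn n → ℝ} (hφ : ContDiff ℝ 2 φ) (hH : IsBddH1 φ) (hW : 0 < ∫ x, g (φ x))
    (hEq : ∀ x, Δ φ x = -2 * f (φ x)) :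
    ∃ ψ : Rn n → ℝ, IsBddH1 ψ ∧ dirichlet ψ / 2 - ∫ x, f' (φ x) * ψ x ^ 2 < 0 := by
  by_contra! hQ
  have hφ1 := hH.contDiff
  have hgφ : ContDiff ℝ 1 fun x => g (φ x) := by
    refine ContDiff.comp (contDiff_one_iff_deriv.2
      ⟨fun s => (hg.hasDerivAt s).differentiableAt, ?_⟩) hφ1
    rw [show deriv g = f from funext fun s => (hg.hasDerivAt s).deriv]
    exact hg.continuous_deriv
  have hdgφ : ∀ x, fderiv ℝ (fun x => g (φ x)) x x = f (φ x) * fderiv ℝ φ x x := fun x => by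
    have h1 := ((hg.hasDerivAt (φ x)).comp_hasFDerivAt x
      (hφ1.differentiable one_ne_zero x).hasFDerivAt).fderiv
    exact congrArg (fun L => L x) h1
  have ig := hg.integrable_comp hH
  let χ : ContDiffBump (0 : Rn n) := ⟨1, 2, one_pos, one_lt_two⟩
  have hχ : ContDiff ℝ 1 χ := χ.contDiff
  have hχ0 : χ 0 = 1 := χ.one_of_mem_closedBall (by simp [χ])
  have cdχ : Continuous fun y => fderiv ℝ χ y y :=
    (hχ.continuous_fderiv one_ne_zero).clm_apply continuous_id
  have cnχ : Continuous fun y => ‖∇ χ y‖ * ‖y‖ := (continuous_gradient hχ).norm.mul continuous_norm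
  -- For `η(x) = χ(εx)` the product `|∇η| |x|` is bounded by `M₁` independently of `ε`. Hence the
  -- cutoff error `|∇η|² (x·∇φ)²` is dominated by `M₁² |∇φ|²`, which is integrable without any decay
  -- of `x·∇φ`.
  obtain ⟨M₁, hM₁⟩ := cnχ.bounded_above_of_compact_support
    (hasCompactSupport_gradient χ.hasCompactSupport).norm.mul_right
  have hdle : ∀ y, |fderiv ℝ χ y y| ≤ M₁ := fun y => by
    have h1 := (fderiv ℝ χ y).le_opNorm y
    have h2 := hM₁ y
    rw [Real.norm_of_nonneg (by positivity), norm_gradient] at h2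
    exact h1.trans h2
  have hineq : ∀ ε : ℝ, ε ≠ 0 → 0 ≤ ∫ x, (‖∇ (fun x => χ (ε • x)) x‖ ^ 2 * fderiv ℝ φ x x ^ 2 / 2
      - 2 * (g (φ x) * (n * χ (ε • x) ^ 2 + 2 * χ (ε • x) * fderiv ℝ χ (ε • x) (ε • x)))) := by
    intro ε hε
    have hη : ContDiff ℝ 1 fun x => χ (ε • x) := hχ.comp (contDiff_const_smul ε)
    have hc : HasCompactSupport fun x => χ (ε • x) :=
      χ.hasCompactSupport.comp_homeomorph (Homeomorph.smulOfNeZero ε hε)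
    have h1 := dilation_nonneg hg hφ hEq
      (fun ψ hψ hψc => hQ ψ (IsBddH1.of_hasCompactSupport hψ hψc)) hη hc
    have hm : ContDiff ℝ 1 fun x => χ (ε • x) ^ 2 := hη.pow 2
    have hmc := hasCompactSupport_sq hc
    have h2 := integral_dilation hgφ hm hmc
    have h3 : ∀ x, fderiv ℝ (fun x => χ (ε • x) ^ 2) x x =
        2 * χ (ε • x) * fderiv ℝ χ (ε • x) (ε • x) := fun x => by
      have e1 : HasFDerivAt (fun x : Rn n => ε • x) (ε • ContinuousLinearMap.id ℝ (Rn n)) x :=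
        (hasFDerivAt_id x).const_smul ε
      have e2 := (((hχ.differentiable one_ne_zero (ε • x)).hasFDerivAt).comp x e1).pow 2
      have e3 := congrArg (fun L => L x) e2.fderiv
      refine Eq.trans e3 ?_
      simp
    simp only [hdgφ, h3] at h2
    have i1 : Integrable fun x => ‖∇ (fun x => χ (ε • x)) x‖ ^ 2 * fderiv ℝ φ x x ^ 2 / 2 := by
      simp only [mul_div_assoc]
      exact (((continuous_gradient hη).norm.pow 2).mul ((((hφ1.continuous_fderiv
        one_ne_zero).clm_apply continuous_id).pow 2).div_const 2)).integrable_of_hasCompactSupport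
        (hasCompactSupport_norm_gradient_sq hc).mul_right
    have i2 : Integrable fun x => f (φ x) * fderiv ℝ φ x x * χ (ε • x) ^ 2 :=
      (((hg.continuous_deriv.comp hφ1.continuous).mul ((hφ1.continuous_fderiv
        one_ne_zero).clm_apply continuous_id)).mul hm.continuous).integrable_of_hasCompactSupport
        hmc.mul_left
    have i3 : Integrable fun x => g (φ x) * (n * χ (ε • x) ^ 2 +
        2 * χ (ε • x) * fderiv ℝ χ (ε • x) (ε • x)) := by
      have c1 : Continuous fun x => fderiv ℝ χ (ε • x) (ε • x) :=
        cdχ.comp (continuous_const_smul ε)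
      refine (hgφ.continuous.mul ((continuous_const.mul hm.continuous).add
        ((continuous_const.mul hη.continuous).mul c1))).integrable_of_hasCompactSupport ?_
      exact HasCompactSupport.mul_left ((HasCompactSupport.mul_left hmc).add
        (HasCompactSupport.mul_left hc).mul_right)
    have h4 : ∀ x, 2 * f (φ x) * fderiv ℝ φ x x * χ (ε • x) ^ 2 =
      2 * (f (φ x) * fderiv ℝ φ x x * χ (ε • x) ^ 2) := fun x => by ring
    simp only [h4] at h1
    rw [integral_add i1 (i2.const_mul 2), integral_const_mul, h2] at h1
    rw [integral_sub i1 (i3.const_mul 2), integral_const_mul]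
    linarith
  have hgrad : ∀ (ε : ℝ) x, ‖∇ (fun x => χ (ε • x)) x‖ ^ 2 * fderiv ℝ φ x x ^ 2 / 2 ≤
      (‖∇ χ (ε • x)‖ * ‖ε • x‖) ^ 2 * ‖∇ φ x‖ ^ 2 / 2 := fun ε x => by
    have h1 : fderiv ℝ φ x x ^ 2 ≤ (‖∇ φ x‖ * ‖x‖) ^ 2 := by
      rw [← sq_abs, norm_gradient]
      exact pow_le_pow_left₀ (abs_nonneg _) ((fderiv ℝ φ x).le_opNorm x) 2
    rw [gradient_comp_smul hχ]
    simp only [norm_smul]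
    calc (‖ε‖ * ‖∇ χ (ε • x)‖) ^ 2 * fderiv ℝ φ x x ^ 2 / 2
        ≤ (‖ε‖ * ‖∇ χ (ε • x)‖) ^ 2 * (‖∇ φ x‖ * ‖x‖) ^ 2 / 2 := by gcongr
      _ = _ := by ring
  have hlim : Tendsto (fun ε : ℝ => ∫ x, (‖∇ (fun x => χ (ε • x)) x‖ ^ 2 * fderiv ℝ φ x x ^ 2 / 2
      - 2 * (g (φ x) * (n * χ (ε • x) ^ 2 + 2 * χ (ε • x) * fderiv ℝ χ (ε • x) (ε • x)))))
      (𝓝[≠] 0) (𝓝 (∫ x, -2 * n * g (φ x))) := by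
    have ib : Integrable fun x => M₁ ^ 2 * ‖∇ φ x‖ ^ 2 / 2 + 2 * (|g (φ x)| * (n + 2 * M₁)) :=
      (((hH.memLp_grad.integrable_norm_pow two_ne_zero).const_mul _).div_const 2).add
        ((ig.abs.mul_const _).const_mul 2)
    refine tendsto_integral_filter_of_dominated_convergence _
      (Eventually.of_forall fun ε => Continuous.aestronglyMeasurable ?_)
      (Eventually.of_forall fun ε => Eventually.of_forall fun x => ?_) ib
      (Eventually.of_forall fun x => ?_)
    · have hη : ContDiff ℝ 1 fun x => χ (ε • x) := hχ.comp (contDiff_const_smul ε)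
      have c1 : Continuous fun x => fderiv ℝ χ (ε • x) (ε • x) :=
        cdχ.comp (continuous_const_smul ε)
      exact (((((continuous_gradient hη).norm.pow 2).mul (((hφ1.continuous_fderiv
        one_ne_zero).clm_apply continuous_id).pow 2)).div_const 2)).sub (continuous_const.mul
        (hgφ.continuous.mul ((continuous_const.mul (hη.continuous.pow 2)).add
        ((continuous_const.mul hη.continuous).mul c1))))
    · have hχ1 : |χ (ε • x)| ≤ 1 := by rw [abs_of_nonneg χ.nonneg]; exact χ.le_one
      refine (norm_sub_le _ _).trans (add_le_add ?_ ?_)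
      · rw [Real.norm_of_nonneg (by positivity)]
        refine (hgrad ε x).trans ?_
        have := hM₁ (ε • x)
        rw [Real.norm_of_nonneg (by positivity)] at this
        gcongr
      · rw [norm_mul, norm_mul, Real.norm_of_nonneg (zero_le_two (α := ℝ)), Real.norm_eq_abs]
        refine mul_le_mul_of_nonneg_left (mul_le_mul_of_nonneg_left ((norm_add_le _ _).trans
          (add_le_add ?_ ?_)) (abs_nonneg _)) zero_le_two
        · rw [norm_mul, Real.norm_of_nonneg (Nat.cast_nonneg n), norm_pow, Real.norm_eq_abs]
          exact mul_le_of_le_one_right (Nat.cast_nonneg n) (pow_le_one₀ (abs_nonneg _) hχ1)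
        · rw [norm_mul, norm_mul, Real.norm_of_nonneg (zero_le_two (α := ℝ)), Real.norm_eq_abs,
            Real.norm_eq_abs, mul_assoc]
          refine mul_le_mul_of_nonneg_left ?_ zero_le_two
          calc |χ (ε • x)| * |fderiv ℝ χ (ε • x) (ε • x)| ≤ 1 * M₁ :=
                mul_le_mul hχ1 (hdle _) (abs_nonneg _) zero_le_one
            _ = M₁ := one_mul _
    · have tε : Tendsto (fun ε : ℝ => ε • x) (𝓝[≠] 0) (𝓝 0) := by
        have : Tendsto (fun ε : ℝ => ε • x) (𝓝 0) (𝓝 ((0 : ℝ) • x)) :=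
          (continuous_id.smul continuous_const).tendsto 0
        rw [zero_smul] at this
        exact this.mono_left nhdsWithin_le_nhds
      have t1 : Tendsto (fun ε : ℝ => χ (ε • x)) (𝓝[≠] 0) (𝓝 1) := by
        rw [← hχ0]; exact (hχ.continuous.tendsto 0).comp tε
      have t2 : Tendsto (fun ε : ℝ => fderiv ℝ χ (ε • x) (ε • x)) (𝓝[≠] 0) (𝓝 0) := by
        have := (cdχ.tendsto 0).comp tε
        simpa [Function.comp_def] using this
      have t3 : Tendsto (fun ε : ℝ => (‖∇ χ (ε • x)‖ * ‖ε • x‖) ^ 2 * ‖∇ φ x‖ ^ 2 / 2)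
          (𝓝[≠] 0) (𝓝 0) := by
        have := ((((cnχ.tendsto 0).comp tε).pow 2).mul_const (‖∇ φ x‖ ^ 2)).div_const 2
        simpa [Function.comp_def] using this
      have t4 := squeeze_zero (fun ε => by positivity) (fun ε => hgrad ε x) t3
      have t5 := t4.sub (((((t1.pow 2).const_mul (n : ℝ)).add
        ((t1.const_mul 2).mul t2)).const_mul (g (φ x))).const_mul 2)
      refine t5.trans (le_of_eq ?_)
      congr 1
      ring
  -- As `ε → 0` only the term from the divergence of `x` survives, and its sign contradicts `W > 0`.
  have h0 : 0 ≤ ∫ x, -2 * n * g (φ x) := by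
    refine ge_of_tendsto hlim ?_
    filter_upwards [self_mem_nhdsWithin] with ε hε using hineq ε hε
  rw [integral_const_mul] at h0
  have : (0 : ℝ) < n := by exact_mod_cast hn
  nlinarith

/-! ### Bounded multiplication operators -/

theorem mem_mulDomain {n : ℕ} {V : Rn n → ℝ} {C : ℝ} (hV : Continuous V) (hC : ∀ x, |V x| ≤ C)
    (u : L2 n) : u ∈ mulDomain V := by
  refine (Lp.memLp u).of_le_mul (c := C) ?_ (Eventually.of_forall fun x => ?_)
  · exact (Complex.continuous_ofReal.comp hV).aestronglyMeasurable.mul (Lp.aestronglyMeasurable u)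
  · rw [norm_mul, Complex.norm_real]
    exact mul_le_mul_of_nonneg_right (hC x) (norm_nonneg _)

/-- Multiplication by a bounded continuous function as a bounded operator on `L²`. -/
noncomputable def mulCLM {n : ℕ} {V : Rn n → ℝ} {C : ℝ} (hV : Continuous V) (hC : ∀ x, |V x| ≤ C) :
    L2 n →L[ℂ] L2 n :=
  LinearMap.mkContinuous
    (mulOp V ∘ₗ LinearMap.codRestrict (mulDomain V) LinearMap.id (mem_mulDomain hV hC)) C fun u => by
      refine Lp.norm_le_mul_norm_of_ae_le_mul ?_
      filter_upwards [MemLp.coeFn_toLp (mem_mulDomain hV hC u)] with x hx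
      refine (congrArg norm hx).trans_le ?_
      rw [norm_mul, Complex.norm_real]
      exact mul_le_mul_of_nonneg_right (hC x) (norm_nonneg _)

theorem coeFn_mulCLM {n : ℕ} {V : Rn n → ℝ} {C : ℝ} (hV : Continuous V) (hC : ∀ x, |V x| ≤ C)
    (u : L2 n) : mulCLM hV hC u =ᵐ[volume] fun x => (V x : ℂ) * u x :=
  MemLp.coeFn_toLp (mem_mulDomain hV hC u)

theorem inner_mulCLM {n : ℕ} {V : Rn n → ℝ} {C : ℝ} (hV : Continuous V) (hC : ∀ x, |V x| ≤ C)
    (u v : L2 n) : inner ℂ u (mulCLM hV hC v) = inner ℂ (mulCLM hV hC u) v := by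
  rw [L2.inner_def, L2.inner_def]
  refine integral_congr_ae ?_
  filter_upwards [coeFn_mulCLM hV hC u, coeFn_mulCLM hV hC v] with x h1 h2
  rw [h1, h2]
  simp
  ring

/-! ### Real functions in the complex space -/

/-- A real square-integrable function as an element of the complex `L²`. -/
noncomputable def realL2 {n : ℕ} {w : Rn n → ℝ} (hw : MemLp w 2) : L2 n := (hw.ofReal (K := ℂ)).toLp

theorem coeFn_realL2 {n : ℕ} {w : Rn n → ℝ} (hw : MemLp w 2) :
    realL2 hw =ᵐ[volume] fun x => (w x : ℂ) :=
  MemLp.coeFn_toLp _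

theorem norm_realL2_sq {n : ℕ} {w : Rn n → ℝ} (hw : MemLp w 2) :
    ‖realL2 hw‖ ^ 2 = ∫ x, w x * w x := by
  have h1 : ((‖realL2 hw‖ ^ 2 : ℝ) : ℂ) = ((∫ x, w x * w x : ℝ) : ℂ) := by
    rw [Complex.ofReal_pow]
    refine (inner_self_eq_norm_sq_to_K (𝕜 := ℂ) (realL2 hw)).symm.trans ?_
    rw [L2.inner_def, ← integral_complex_ofReal]
    refine integral_congr_ae ?_
    filter_upwards [coeFn_realL2 hw] with x hx
    rw [hx, inner_self_eq_norm_sq_to_K]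
    simp only [Complex.norm_real, Real.norm_eq_abs, Complex.coe_algebraMap]
    rw [← Complex.ofReal_pow, sq_abs, pow_two]
  exact_mod_cast h1

theorem realL2_sub {n : ℕ} {w w' : Rn n → ℝ} (hw : MemLp w 2) (hw' : MemLp w' 2) :
    realL2 hw - realL2 hw' = realL2 (hw.sub hw') := by
  apply Lp.ext
  filter_upwards [Lp.coeFn_sub (realL2 hw) (realL2 hw'), coeFn_realL2 hw, coeFn_realL2 hw',
    coeFn_realL2 (hw.sub hw')] with x h1 h2 h3 h4
  rw [h1, h4, Pi.sub_apply, h2, h3]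
  simp

theorem mulCLM_realL2 {n : ℕ} {V : Rn n → ℝ} {C : ℝ} (hV : Continuous V) (hC : ∀ x, |V x| ≤ C)
    {w : Rn n → ℝ} (hw : MemLp w 2) (hVw : MemLp (fun x => V x * w x) 2) :
    mulCLM hV hC (realL2 hw) = realL2 hVw := by
  apply Lp.ext
  filter_upwards [coeFn_mulCLM hV hC (realL2 hw), coeFn_realL2 hw, coeFn_realL2 hVw] with x h1 h2 h3
  rw [h1, h2, h3]
  simp

theorem memLp_mul_of_bounded {n : ℕ} {V : Rn n → ℝ} {C : ℝ} (hV : Continuous V)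
    (hC : ∀ x, |V x| ≤ C) {w : Rn n → ℝ} (hw : MemLp w 2) : MemLp (fun x => V x * w x) 2 := by
  refine hw.of_le_mul (c := C) (hV.aestronglyMeasurable.mul hw.1) (Eventually.of_forall fun x => ?_)
  rw [norm_mul]
  exact mul_le_mul_of_nonneg_right (hC x) (norm_nonneg _)

theorem integral_mul_sq_le {n : ℕ} {u v : Rn n → ℝ} (hu : MemLp u 2) (hv : MemLp v 2) :
    (∫ x, u x * v x) ^ 2 ≤ (∫ x, u x * u x) * ∫ x, v x * v x := by
  have h1 : inner ℂ (realL2 hu) (realL2 hv) = ((∫ x, u x * v x : ℝ) : ℂ) := by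
    rw [L2.inner_def, ← integral_complex_ofReal]
    refine integral_congr_ae ?_
    filter_upwards [coeFn_realL2 hu, coeFn_realL2 hv] with x h1 h2
    rw [h1, h2]
    simp [mul_comm]
  have h2 := norm_inner_le_norm (𝕜 := ℂ) (realL2 hu) (realL2 hv)
  rw [h1, Complex.norm_real] at h2
  rw [← norm_realL2_sq hu, ← norm_realL2_sq hv, ← mul_pow, ← sq_abs]
  exact pow_le_pow_left₀ (abs_nonneg _) h2 2

/-! ### Real and imaginary parts of Schwartz functions -/

theorem contDiff_clm_comp_schwartz {n : ℕ} (c : ℂ →L[ℝ] ℝ) (y : 𝓢(Rn n, ℂ)) :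
    ContDiff ℝ 1 fun x => c (y x) :=
  c.contDiff.comp (y.smooth 1)

theorem fderiv_clm_comp_schwartz {n : ℕ} (c : ℂ →L[ℝ] ℝ) (y : 𝓢(Rn n, ℂ)) (x e : Rn n) :
    fderiv ℝ (fun x => c (y x)) x e = c ((∂_{e} y) x) := by
  have h := (c.hasFDerivAt.comp x (y.hasFDerivAt x)).fderiv
  rw [SchwartzMap.lineDerivOp_apply_eq_fderiv]
  exact congrArg (fun L => L e) h

theorem memLp_clm_comp_schwartz {n : ℕ} (c : ℂ →L[ℝ] ℝ) (y : 𝓢(Rn n, ℂ)) :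
    MemLp (fun x => c (y x)) 2 :=
  c.comp_memLp' (y.memLp 2)

theorem isBddH1_clm_comp_schwartz {n : ℕ} (c : ℂ →L[ℝ] ℝ) (y : 𝓢(Rn n, ℂ)) :
    IsBddH1 fun x => c (y x) where
  contDiff := contDiff_clm_comp_schwartz c y
  bounded := by
    refine ⟨‖c‖ * ‖y.toBoundedContinuousFunction‖, fun x => (c.le_opNorm _).trans ?_⟩
    exact mul_le_mul_of_nonneg_left (y.toBoundedContinuousFunction.norm_coe_le_norm x)
      (norm_nonneg _)
  memLp := memLp_clm_comp_schwartz c y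
  memLp_grad := by
    have h1 : MemLp (SchwartzMap.fderivCLM ℝ (Rn n) ℂ y) 2 volume := SchwartzMap.memLp _ 2 volume
    refine h1.of_le_mul (c := ‖c‖)
      (continuous_gradient (contDiff_clm_comp_schwartz c y)).aestronglyMeasurable
      (Eventually.of_forall fun x => ?_)
    rw [norm_gradient, show fderiv ℝ (fun x => c (y x)) x = c.comp (fderiv ℝ y x) from
      (c.hasFDerivAt.comp x (y.hasFDerivAt x)).fderiv]
    simpa only [SchwartzMap.fderivCLM_apply] using c.opNorm_comp_le (fderiv ℝ y x)

theorem IsBddH1.memLp_fderiv_apply {n : ℕ} {u : Rn n → ℝ} (hu : IsBddH1 u) (e : Rn n) :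
    MemLp (fun x => fderiv ℝ u x e) 2 := by
  refine hu.memLp_grad.of_le_mul (c := ‖e‖) ((hu.contDiff.continuous_fderiv one_ne_zero).clm_apply
    continuous_const).aestronglyMeasurable (Eventually.of_forall fun x => ?_)
  rw [norm_gradient, mul_comm]
  exact (fderiv ℝ u x).le_opNorm e

/-- No compact support is needed: every product that occurs is a product of two `L²` functions,
hence integrable. -/
theorem IsBddH1.integral_inner_gradient_schwartz {n : ℕ} {u : Rn n → ℝ} (hu : IsBddH1 u)
    (c : ℂ →L[ℝ] ℝ) (y : 𝓢(Rn n, ℂ)) :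
    ∫ x, inner ℝ (∇ u x) (∇ (fun x => c (y x)) x) = - ∫ x, u x * c (schwartzLaplacian n y x) := by
  have h1 : ∀ x, u x * c (schwartzLaplacian n y x) = ∑ i, u x * c
      ((∂_{EuclideanSpace.basisFun (Fin n) ℝ i} (∂_{EuclideanSpace.basisFun (Fin n) ℝ i} y)) x) :=
    fun x => by rw [schwartzLaplacian_eq_sum, sum_apply, map_sum, Finset.mul_sum]
  simp only [inner_gradient_eq_sum, h1]
  rw [integral_finsetSum, integral_finsetSum, ← Finset.sum_neg_distrib]
  · refine Finset.sum_congr rfl fun i _ => ?_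
    set e := EuclideanSpace.basisFun (Fin n) ℝ i
    simp only [fderiv_clm_comp_schwartz]
    have h2 := integral_mul_fderiv_eq_neg_fderiv_mul_of_integrable (μ := volume) (v := e)
      (f := u) (g := fun x => c ((∂_{e} y) x))
      ((hu.memLp_fderiv_apply e).integrable_mul (memLp_clm_comp_schwartz c _))
      (by
        simp only [fderiv_clm_comp_schwartz]
        exact hu.memLp.integrable_mul (memLp_clm_comp_schwartz c _))
      (hu.memLp.integrable_mul (memLp_clm_comp_schwartz c _))
      (fun x _ => hu.contDiff.differentiable one_ne_zero x)
      (fun x _ => (contDiff_clm_comp_schwartz c _).differentiable one_ne_zero x)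
    simp only [fderiv_clm_comp_schwartz] at h2
    rw [h2, neg_neg]
  · exact fun i _ => hu.memLp.integrable_mul (memLp_clm_comp_schwartz c _)
  · exact fun i _ => (hu.memLp_fderiv_apply _).integrable_mul
      ((isBddH1_clm_comp_schwartz c y).memLp_fderiv_apply _)

/-! ### The quadratic form -/

/-- Bounded `C¹` functions in `H¹`, as a real vector space. -/
def bddH1 (n : ℕ) : Submodule ℝ (Rn n → ℝ) where
  carrier := {u | IsBddH1 u}
  add_mem' hu hv := hu.add hv
  zero_mem' := IsBddH1.of_hasCompactSupport (u := fun _ => 0) contDiff_const HasCompactSupport.zero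
  smul_mem' c _ hu := hu.const_mul c

/-- The `L²` inner product on `bddH1`. -/
noncomputable def massForm (n : ℕ) : LinearMap.BilinForm ℝ (bddH1 n) :=
  LinearMap.mk₂ ℝ (fun u v => ∫ x, u.1 x * v.1 x)
    (fun u u' v => by
      simp only [Submodule.coe_add, Pi.add_apply, add_mul]
      exact integral_add (u.2.integrable_mul v.2) (u'.2.integrable_mul v.2))
    (fun c u v => by
      simp only [Submodule.coe_smul, Pi.smul_apply, smul_eq_mul, mul_assoc]
      exact integral_const_mul _ _)
    (fun u v v' => by
      simp only [Submodule.coe_add, Pi.add_apply, mul_add]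
      exact integral_add (u.2.integrable_mul v.2) (u.2.integrable_mul v'.2))
    (fun c u v => by
      simp only [Submodule.coe_smul, Pi.smul_apply, smul_eq_mul, mul_left_comm _ c]
      exact integral_const_mul _ _)

/-- The Dirichlet form on `bddH1`. -/
noncomputable def dirichletForm (n : ℕ) : LinearMap.BilinForm ℝ (bddH1 n) :=
  LinearMap.mk₂ ℝ (fun u v => ∫ x, inner ℝ (∇ u.1 x) (∇ v.1 x))
    (fun u u' v => by
      have h : ∀ x, ∇ (u + u' : bddH1 n).1 x = ∇ u.1 x + ∇ u'.1 x :=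
        congrFun (gradient_add' u.2.contDiff u'.2.contDiff)
      simp only [h, inner_add_left]
      exact integral_add (u.2.integrable_inner v.2) (u'.2.integrable_inner v.2))
    (fun c u v => by
      have h : ∀ x, ∇ (c • u : bddH1 n).1 x = c • ∇ u.1 x :=
        congrFun (gradient_const_mul' u.2.contDiff c)
      simp only [h, real_inner_smul_left]
      exact integral_const_mul _ _)
    (fun u v v' => by
      have h : ∀ x, ∇ (v + v' : bddH1 n).1 x = ∇ v.1 x + ∇ v'.1 x :=
        congrFun (gradient_add' v.2.contDiff v'.2.contDiff)
      simp only [h, inner_add_right]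
      exact integral_add (u.2.integrable_inner v.2) (u.2.integrable_inner v'.2))
    (fun c u v => by
      have h : ∀ x, ∇ (c • v : bddH1 n).1 x = c • ∇ v.1 x :=
        congrFun (gradient_const_mul' v.2.contDiff c)
      simp only [h, real_inner_smul_right]
      exact integral_const_mul _ _)

/-- The form `∫ V u v` on `bddH1`. -/
noncomputable def potentialForm {n : ℕ} {V : Rn n → ℝ} {C : ℝ} (hV : Continuous V)
    (hC : ∀ x, |V x| ≤ C) : LinearMap.BilinForm ℝ (bddH1 n) :=
  LinearMap.mk₂ ℝ (fun u v => ∫ x, V x * u.1 x * v.1 x)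
    (fun u u' v => by
      simp only [Submodule.coe_add, Pi.add_apply, mul_add, add_mul]
      exact integral_add ((memLp_mul_of_bounded hV hC u.2.memLp).integrable_mul v.2.memLp)
        ((memLp_mul_of_bounded hV hC u'.2.memLp).integrable_mul v.2.memLp))
    (fun c u v => by
      simp only [Submodule.coe_smul, Pi.smul_apply, smul_eq_mul, mul_left_comm _ c, mul_assoc]
      exact integral_const_mul _ _)
    (fun u v v' => by
      simp only [Submodule.coe_add, Pi.add_apply, mul_add]
      exact integral_add ((memLp_mul_of_bounded hV hC u.2.memLp).integrable_mul v.2.memLp)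
        ((memLp_mul_of_bounded hV hC u.2.memLp).integrable_mul v'.2.memLp))
    (fun c u v => by
      simp only [Submodule.coe_smul, Pi.smul_apply, smul_eq_mul, mul_left_comm _ c]
      exact integral_const_mul _ _)

/-- The functional `u ↦ ∫ F u` on `bddH1`. -/
noncomputable def pairingForm {n : ℕ} {F : Rn n → ℝ} (hF : MemLp F 2) : bddH1 n →ₗ[ℝ] ℝ where
  toFun u := ∫ x, F x * u.1 x
  map_add' u v := by
    simp only [Submodule.coe_add, Pi.add_apply, mul_add]
    exact integral_add (hF.integrable_mul u.2.memLp) (hF.integrable_mul v.2.memLp)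
  map_smul' c u := by
    simp only [Submodule.coe_smul, Pi.smul_apply, smul_eq_mul, mul_left_comm _ c]
    exact integral_const_mul _ _

/-- With the real and imaginary parts as functionals, complex test functions reduce to real
integrals. -/
theorem clm_toTemperedDistribution_realL2 {n : ℕ} {w : Rn n → ℝ} (hw : MemLp w 2) (c : ℂ →L[ℝ] ℝ)
    (y : 𝓢(Rn n, ℂ)) : c ((realL2 hw : 𝓢'(Rn n, ℂ)) y) = ∫ x, w x * c (y x) := by
  rw [Lp.toTemperedDistribution_apply]
  have h1 : ∫ x, y x • realL2 hw x = ∫ x, w x • y x := by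
    refine integral_congr_ae ?_
    filter_upwards [coeFn_realL2 hw] with x hx
    rw [hx, smul_eq_mul, mul_comm, Complex.real_smul]
  have h2 : Integrable fun x => w x • y x := 
    memLp_one_iff_integrable.1 ((y.memLp 2 volume).smul hw (r := 1))
  rw [h1, ← c.integral_comp_comm h2]
  simp only [map_smul, smul_eq_mul]

/-! ### The energy form and its weak eigenfunction -/

variable {n : ℕ} {c κ C : ℝ} {V F : Rn n → ℝ}

/-- The form of `-½ Δ + c - V` on `bddH1`. -/
noncomputable def energyForm (c : ℝ) (hV : Continuous V) (hC : ∀ x, |V x| ≤ C) :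
    LinearMap.BilinForm ℝ (bddH1 n) :=
  (1 / 2 : ℝ) • dirichletForm n + c • massForm n - potentialForm hV hC

theorem energyForm_apply (hV : Continuous V) (hC : ∀ x, |V x| ≤ C) (u v : bddH1 n) :
    energyForm c hV hC u v = 1 / 2 * (∫ x, inner ℝ (∇ u.1 x) (∇ v.1 x))
      + c * (∫ x, u.1 x * v.1 x) - ∫ x, V x * u.1 x * v.1 x := rfl

theorem massForm_isSymm (n : ℕ) : (massForm n).IsSymm :=
  ⟨fun u v => integral_congr_ae (Eventually.of_forall fun x => mul_comm _ _)⟩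

theorem energyForm_isSymm (hV : Continuous V) (hC : ∀ x, |V x| ≤ C) :
    (energyForm c hV hC).IsSymm := by
  refine ⟨fun u v => ?_⟩
  simp only [energyForm_apply]
  have h1 : ∀ x, inner ℝ (∇ u.1 x) (∇ v.1 x) = inner ℝ (∇ v.1 x) (∇ u.1 x) := fun x =>
    real_inner_comm _ _
  have h2 : ∀ x, u.1 x * v.1 x = v.1 x * u.1 x := fun x => mul_comm _ _
  have h3 : ∀ x, V x * u.1 x * v.1 x = V x * v.1 x * u.1 x := fun x => mul_right_comm _ _ _
  simp only [h1, h2, h3]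

theorem energyForm_schwartz (hV : Continuous V) (hC : ∀ x, |V x| ≤ C) (u : bddH1 n)
    (l : ℂ →L[ℝ] ℝ) (y : 𝓢(Rn n, ℂ)) :
    energyForm c hV hC u ⟨fun x => l (y x), isBddH1_clm_comp_schwartz l y⟩ =
      -(1 / 2) * (∫ x, u.1 x * l (schwartzLaplacian n y x)) + c * (∫ x, u.1 x * l (y x))
        - ∫ x, V x * u.1 x * l (y x) := by
  rw [energyForm_apply, u.2.integral_inner_gradient_schwartz]
  ring

theorem tendsto_apply_schwartz {f : ℕ → L2 n} {g : L2 n} (h : Tendsto f atTop (𝓝 g))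
    (y : 𝓢(Rn n, ℂ)) :
    Tendsto (fun k => (f k : 𝓢'(Rn n, ℂ)) y) atTop (𝓝 ((g : 𝓢'(Rn n, ℂ)) y)) := by
  have h1 : Continuous fun f : L2 n =>
      Lp.toTemperedDistributionCLM ℂ (volume : Measure (Rn n)) 2 f y :=
    (PointwiseConvergenceCLM.evalCLM (RingHom.id ℂ) ℂ y).continuous.comp
      (Lp.toTemperedDistributionCLM ℂ (volume : Measure (Rn n)) 2).continuous
  exact (h1.tendsto g).comp h

/-- The infimum of a negative energy form with a rank-one lower bound is attained at a weak
eigenfunction. -/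
theorem exists_weak_eigenfunction (hV : Continuous V) (hC : ∀ x, |V x| ≤ C) (hF : MemLp F 2)
    (hκ : 0 ≤ κ) (hQ : ∀ u : bddH1 n, -κ * (∫ x, F x * u.1 x) ^ 2 ≤ energyForm c hV hC u u)
    {u₀ : bddH1 n} (hu₀ : energyForm c hV hC u₀ u₀ < 0) :
    ∃ E < 0, ∃ ψ : L2 n, ψ ≠ 0 ∧ Δ (ψ : 𝓢'(Rn n, ℂ)) =
      (((2 * (c - E) : ℝ) : ℂ) • ψ - (2 : ℂ) • mulCLM hV hC ψ : L2 n) := by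
  obtain ⟨E, hE, u, hu1, huc, hlim⟩ := exists_cauchy_minimizing_sequence (energyForm c hV hC)
    (massForm n) (pairingForm hF) (energyForm_isSymm hV hC) (massForm_isSymm n)
    (fun u => integral_nonneg fun x => mul_self_nonneg _) hκ hQ
    (fun u => integral_mul_sq_le hF u.2.memLp) hu₀
  set U : ℕ → L2 n := fun k => realL2 (u k).2.memLp with hU
  have hUc : CauchySeq U := by
    rw [Metric.cauchySeq_iff]
    intro ε hε
    obtain ⟨N, hN⟩ := huc (ε ^ 2) (by positivity)
    refine ⟨N, fun k hk l hl => ?_⟩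
    rw [dist_eq_norm]
    refine lt_of_pow_lt_pow_left₀ 2 hε.le ?_
    simp only [hU]
    rw [realL2_sub, norm_realL2_sq]
    exact hN k hk l hl
  obtain ⟨ψ, hψ⟩ := cauchySeq_tendsto_of_complete hUc
  have hU1 : ∀ k, ‖U k‖ = 1 := fun k => by
    have h1 : ‖U k‖ ^ 2 = 1 := (norm_realL2_sq _).trans (hu1 k)
    exact (pow_eq_one_iff_of_nonneg (norm_nonneg _) two_ne_zero).1 h1
  have hψ1 : ‖ψ‖ = 1 := by
    refine tendsto_nhds_unique hψ.norm ?_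
    simp only [hU1]
    exact tendsto_const_nhds
  refine ⟨E, hE, ψ, fun h => by simp [h] at hψ1, ?_⟩
  ext y
  rw [laplacian_apply_apply, ← schwartzLaplacian_eq]
  set R : L2 n → L2 n := fun f => ((2 * (c - E) : ℝ) : ℂ) • f - (2 : ℂ) • mulCLM hV hC f with hR
  have hRc : Continuous R := by
    simp only [hR]
    exact (continuous_id.const_smul ((2 * (c - E) : ℝ) : ℂ)).sub
      ((mulCLM hV hC).continuous.const_smul (2 : ℂ))
  have hZ : Tendsto (fun k => (U k : 𝓢'(Rn n, ℂ)) (schwartzLaplacian n y) -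
      (R (U k) : 𝓢'(Rn n, ℂ)) y) atTop (𝓝 ((ψ : 𝓢'(Rn n, ℂ)) (schwartzLaplacian n y) -
      (R ψ : 𝓢'(Rn n, ℂ)) y)) :=
    (tendsto_apply_schwartz hψ _).sub (tendsto_apply_schwartz ((hRc.tendsto ψ).comp hψ) y)
  -- The defect in the eigenvalue equation, tested against `y`, is `-2` times the defect that tends
  -- to zero along the minimizing sequence; the factor comes from the `½` before the Laplacian.
  have hcomp : ∀ (l : ℂ →L[ℝ] ℝ) k, l ((U k : 𝓢'(Rn n, ℂ)) (schwartzLaplacian n y) -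
      (R (U k) : 𝓢'(Rn n, ℂ)) y) = -2 * (energyForm c hV hC (u k)
        ⟨fun x => l (y x), isBddH1_clm_comp_schwartz l y⟩ - E * massForm n (u k)
        ⟨fun x => l (y x), isBddH1_clm_comp_schwartz l y⟩) := by
    intro l k
    have m1 := (u k).2.memLp
    have m2 := memLp_mul_of_bounded hV hC m1
    have m3 : MemLp (fun x => 2 * (c - E) * (u k).1 x - 2 * (V x * (u k).1 x)) 2 :=
      (m1.const_mul _).sub (m2.const_mul 2)
    have e1 : R (U k) = realL2 m3 := by
      simp only [hR, hU]
      rw [mulCLM_realL2 hV hC m1 m2]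
      apply Lp.ext
      filter_upwards [Lp.coeFn_sub (((2 * (c - E) : ℝ) : ℂ) • realL2 m1) ((2 : ℂ) • realL2 m2),
        Lp.coeFn_smul (((2 * (c - E) : ℝ) : ℂ)) (realL2 m1), Lp.coeFn_smul (2 : ℂ) (realL2 m2),
        coeFn_realL2 m1, coeFn_realL2 m2, coeFn_realL2 m3] with x h1 h2 h3 h4 h5 h6
      rw [h1, Pi.sub_apply, h2, h3, h6, Pi.smul_apply, Pi.smul_apply, h4, h5]
      push_cast
      simp only [smul_eq_mul]
    have i1 : Integrable fun x => (u k).1 x * l (y x) :=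
      m1.integrable_mul (memLp_clm_comp_schwartz l y)
    have i2 : Integrable fun x => V x * (u k).1 x * l (y x) :=
      m2.integrable_mul (memLp_clm_comp_schwartz l y)
    rw [map_sub, e1, clm_toTemperedDistribution_realL2, clm_toTemperedDistribution_realL2,
      energyForm_schwartz]
    have e2 : ∫ x, (2 * (c - E) * (u k).1 x - 2 * (V x * (u k).1 x)) * l (y x) =
        2 * (c - E) * (∫ x, (u k).1 x * l (y x)) - 2 * ∫ x, V x * (u k).1 x * l (y x) := by
      rw [← integral_const_mul, ← integral_const_mul, ← integral_sub (i1.const_mul _)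
        (i2.const_mul 2)]
      congr 1
      ext x
      ring
    have e3 : massForm n (u k) ⟨fun x => l (y x), isBddH1_clm_comp_schwartz l y⟩ =
      ∫ x, (u k).1 x * l (y x) := rfl
    rw [e2, e3]
    ring
  have hzero : ∀ l : ℂ →L[ℝ] ℝ, l ((ψ : 𝓢'(Rn n, ℂ)) (schwartzLaplacian n y) -
      (R ψ : 𝓢'(Rn n, ℂ)) y) = 0 := fun l => by
    refine tendsto_nhds_unique ((l.continuous.tendsto _).comp hZ) ?_
    simp only [Function.comp_def, hcomp]
    simpa using (hlim ⟨fun x => l (y x), isBddH1_clm_comp_schwartz l y⟩).const_mul (-2)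
  exact sub_eq_zero.1 (Complex.ext (hzero Complex.reCLM) (hzero Complex.imCLM))

/-! ### The operator on `H²` and its lower bound -/

/-- The operator `-½ Δ + c - V` on `H²` for bounded `V`. -/
noncomputable def hamiltonian (c : ℝ) (hV : Continuous V) (hC : ∀ x, |V x| ≤ C) :
    H2 n →ₗ[ℂ] L2 n :=
  (-(1 / 2) : ℂ) • laplacianH2 n + (c : ℂ) • (H2 n).subtype
    - (mulCLM hV hC : L2 n →ₗ[ℂ] L2 n) ∘ₗ (H2 n).subtype

theorem hamiltonian_apply (hV : Continuous V) (hC : ∀ x, |V x| ≤ C) (u : H2 n) :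
    hamiltonian c hV hC u = (-(1 / 2) : ℂ) • laplacianH2 n u + (c : ℂ) • (u : L2 n)
      - mulCLM hV hC u := rfl

theorem inner_hamiltonian (hV : Continuous V) (hC : ∀ x, |V x| ≤ C) (u v : H2 n) :
    inner ℂ (u : L2 n) (hamiltonian c hV hC v) = inner ℂ (hamiltonian c hV hC u) (v : L2 n) := by
  simp only [hamiltonian_apply, inner_sub_right, inner_sub_left, inner_add_right, inner_add_left,
    inner_smul_right, inner_smul_left, inner_laplacianH2, inner_mulCLM]
  simp [map_ofNat]

/-- Since `V` and `F` are real, both the energy and `|⟨F, y⟩|²` split into the contributions of the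
real and imaginary parts of `y`, and the real bound applies to each. -/
theorem re_inner_schwartz_ge (hV : Continuous V) (hC : ∀ x, |V x| ≤ C) (hF : MemLp F 2)
    (hQ : ∀ u : bddH1 n, -κ * (∫ x, F x * u.1 x) ^ 2 ≤ energyForm c hV hC u u) (y : 𝓢(Rn n, ℂ)) :
    -κ * ‖inner ℂ (realL2 hF) (schwartzL2 n y)‖ ^ 2 ≤ (inner ℂ (schwartzL2 n y)
      ((-(1 / 2) : ℂ) • schwartzL2 n (schwartzLaplacian n y) + (c : ℂ) • schwartzL2 n y
        - mulCLM hV hC (schwartzL2 n y))).re := by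
  set r : bddH1 n := ⟨fun x => Complex.reCLM (y x), isBddH1_clm_comp_schwartz _ y⟩ with hr
  set s : bddH1 n := ⟨fun x => Complex.imCLM (y x), isBddH1_clm_comp_schwartz _ y⟩ with hs
  have mr : MemLp (fun x => (y x).re) 2 := memLp_clm_comp_schwartz Complex.reCLM y
  have ms : MemLp (fun x => (y x).im) 2 := memLp_clm_comp_schwartz Complex.imCLM y
  have mr' : MemLp (fun x => (schwartzLaplacian n y x).re) 2 :=
    memLp_clm_comp_schwartz Complex.reCLM _
  have ms' : MemLp (fun x => (schwartzLaplacian n y x).im) 2 :=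
    memLp_clm_comp_schwartz Complex.imCLM _
  have h1 : ‖inner ℂ (realL2 hF) (schwartzL2 n y)‖ ^ 2 =
      (∫ x, F x * (y x).re) ^ 2 + (∫ x, F x * (y x).im) ^ 2 := by
    have i1 : Integrable fun x => F x • y x :=
      memLp_one_iff_integrable.1 ((y.memLp 2 volume).smul hF (r := 1))
    have e1 : inner ℂ (realL2 hF) (schwartzL2 n y) = ∫ x, F x • y x := by
      rw [L2.inner_def]
      refine integral_congr_ae ?_
      filter_upwards [coeFn_realL2 hF, coeFn_schwartzL2 y] with x h1 h2
      rw [h1, h2]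
      simp [mul_comm]
    have e2 := Complex.reCLM.integral_comp_comm i1
    have e3 := Complex.imCLM.integral_comp_comm i1
    simp only [map_smul, smul_eq_mul] at e2 e3
    rw [e1, Complex.sq_norm, Complex.normSq_apply]
    simp only [Complex.reCLM_apply, Complex.imCLM_apply] at e2 e3
    rw [← e2, ← e3]
    ring
  have key : ∀ (f : L2 n) (z : Rn n → ℂ), f =ᵐ[volume] z →
      MemLp (fun x => (z x).re) 2 → MemLp (fun x => (z x).im) 2 →
      (inner ℂ (schwartzL2 n y) f).re =
        (∫ x, (y x).re * (z x).re) + ∫ x, (y x).im * (z x).im := by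
    intro f z hf hz1 hz2
    have i0 : Integrable fun x => inner ℂ (schwartzL2 n y x) (f x) :=
      L2.integrable_inner (𝕜 := ℂ) (schwartzL2 n y) f
    have i1 : Integrable fun x => (y x).re * (z x).re := mr.integrable_mul hz1
    have i2 : Integrable fun x => (y x).im * (z x).im := ms.integrable_mul hz2
    rw [L2.inner_def, ← Complex.reCLM_apply, ← Complex.reCLM.integral_comp_comm i0,
      ← integral_add i1 i2]
    refine integral_congr_ae ?_
    filter_upwards [coeFn_schwartzL2 y, hf] with x h1 h2
    rw [h1, h2]
    simp
    ring
  have k1 := key (schwartzL2 n (schwartzLaplacian n y)) _ (coeFn_schwartzL2 _) mr' ms'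
  have k2 := key (schwartzL2 n y) _ (coeFn_schwartzL2 _) mr ms
  have hVy : mulCLM hV hC (schwartzL2 n y) =ᵐ[volume] fun x => (V x : ℂ) * y x := by
    filter_upwards [coeFn_mulCLM hV hC (schwartzL2 n y), coeFn_schwartzL2 y] with x h1 h2
    rw [h1, h2]
  have k3 := key (mulCLM hV hC (schwartzL2 n y)) _ hVy
    (by simpa using memLp_mul_of_bounded hV hC mr) (by simpa using memLp_mul_of_bounded hV hC ms)
  have q1 := hQ r
  have q2 := hQ s
  rw [hr, energyForm_schwartz] at q1
  rw [hs, energyForm_schwartz] at q2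
  simp only [Complex.reCLM_apply, Complex.imCLM_apply] at q1 q2
  have v1 : ∫ x, (y x).re * ((V x : ℂ) * y x).re = ∫ x, V x * (y x).re * (y x).re := by
    congr 1; ext x; simp; ring
  have v2 : ∫ x, (y x).im * ((V x : ℂ) * y x).im = ∫ x, V x * (y x).im * (y x).im := by
    congr 1; ext x; simp; ring
  rw [v1, v2] at k3
  have e : (-(1 / 2) : ℂ) = ((-(1 / 2) : ℝ) : ℂ) := by push_cast; ring
  rw [inner_sub_right, inner_add_right, inner_smul_right, inner_smul_right, Complex.sub_re,
    Complex.add_re, e, Complex.re_ofReal_mul, Complex.re_ofReal_mul, k1, k2, k3, h1]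
  linarith

theorem re_inner_hamiltonian_ge (hV : Continuous V) (hC : ∀ x, |V x| ≤ C) (hF : MemLp F 2)
    (hQ : ∀ u : bddH1 n, -κ * (∫ x, F x * u.1 x) ^ 2 ≤ energyForm c hV hC u u) (u : H2 n) :
    -κ * ‖inner ℂ (realL2 hF) (u : L2 n)‖ ^ 2 ≤
      (inner ℂ (u : L2 n) (hamiltonian c hV hC u)).re := by
  obtain ⟨y, hy, hyΔ⟩ := exists_schwartz_tendsto u
  have t1 : Tendsto (fun k => -κ * ‖inner ℂ (realL2 hF) (schwartzL2 n (y k))‖ ^ 2) atTop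
      (𝓝 (-κ * ‖inner ℂ (realL2 hF) (u : L2 n)‖ ^ 2)) :=
    (((tendsto_const_nhds.inner hy).norm).pow 2).const_mul _
  have t2 := hy.inner (𝕜 := ℂ) (((hyΔ.const_smul (-(1 / 2) : ℂ)).add (hy.const_smul (c : ℂ))).sub
    (((mulCLM hV hC).continuous.tendsto _).comp hy))
  exact le_of_tendsto_of_tendsto' t1 ((Complex.continuous_re.tendsto _).comp t2)
    fun k => re_inner_schwartz_ge hV hC hF hQ (y k)

/-! ### Symmetric operators that are nonnegative up to a form of rank one -/

section Abstract

variable {H : Type*} [NormedAddCommGroup H] [InnerProductSpace ℂ H] {D : Submodule ℂ H}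
  {A : D →ₗ[ℂ] H} {f : H}

/-- The form is nonnegative on the orthogonal complement of `f`, so strictly negative energy is
impossible there. -/
theorem eq_zero_of_inner_eq_zero
    (hA : ∀ u : D, -κ * ‖inner ℂ f (u : H)‖ ^ 2 ≤ (inner ℂ (u : H) (A u)).re) {u : D} {E : ℝ}
    (hE : E < 0) (hu : (inner ℂ (u : H) (A u)).re ≤ E * ‖(u : H)‖ ^ 2)
    (h0 : inner ℂ f (u : H) = 0) : u = 0 := by
  have h1 := hA u
  rw [h0, norm_zero, zero_pow two_ne_zero, mul_zero] at h1
  have h2 : ‖(u : H)‖ ^ 2 = 0 := by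
    have := sq_nonneg ‖(u : H)‖
    nlinarith
  have h3 : (u : H) = 0 := by simpa using h2
  exact_mod_cast h3

theorem re_inner_smul_eigenvector {u v : H} {E : ℝ} (h : v = (E : ℂ) • u) :
    (inner ℂ u v).re = E * ‖u‖ ^ 2 := by
  rw [h, inner_smul_right, Complex.re_ofReal_mul]
  congr 1
  exact inner_self_eq_norm_sq (𝕜 := ℂ) u

/-- Two negative eigenvalues coincide. -/
theorem eigenvalue_unique (hs : ∀ u v : D, inner ℂ (u : H) (A v) = inner ℂ (A u) (v : H))
    (hA : ∀ u : D, -κ * ‖inner ℂ f (u : H)‖ ^ 2 ≤ (inner ℂ (u : H) (A u)).re) {u u' : D}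
    {E E' : ℝ} (hE : E < 0) (hE' : E' < 0) (hu0 : u ≠ 0) (hu0' : u' ≠ 0)
    (hu : A u = (E : ℂ) • (u : H)) (hu' : A u' = (E' : ℂ) • (u' : H)) : E' = E := by
  by_contra hne
  have horth : inner ℂ (u : H) (u' : H) = 0 := by
    have h1 := hs u u'
    rw [hu, hu', inner_smul_right, inner_smul_left, Complex.conj_ofReal] at h1
    have h2 : ((E' - E : ℝ) : ℂ) * inner ℂ (u : H) (u' : H) = 0 := by
      push_cast
      linear_combination h1
    refine (mul_eq_zero.1 h2).resolve_left ?_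
    exact_mod_cast sub_ne_zero.2 hne
  obtain ⟨a, ha⟩ : ∃ a, a = inner ℂ f (u' : H) := ⟨_, rfl⟩
  obtain ⟨b, hb⟩ : ∃ b, b = inner ℂ f (u : H) := ⟨_, rfl⟩
  have hb0 : b ≠ 0 := fun h => hu0
    (eq_zero_of_inner_eq_zero hA hE (re_inner_smul_eigenvector hu).le (hb.symm.trans h))
  -- These coefficients make `v` orthogonal to `f`. Its energy is at most `max E E'` times its
  -- squared norm, so `v = 0`; orthogonality of `u` and `u'` then contradicts `b ≠ 0`.
  obtain ⟨v, hv⟩ : ∃ v, v = a • u - b • u' := ⟨_, rfl⟩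
  have hvc : (v : H) = a • (u : H) - b • (u' : H) := by rw [hv]; rfl
  have z1 : inner ℂ (a • (u : H)) (b • (u' : H)) = 0 := by
    rw [inner_smul_left, inner_smul_right, horth, mul_zero, mul_zero]
  have z2 : inner ℂ (b • (u' : H)) (a • (u : H)) = 0 := inner_eq_zero_symm.1 z1
  have hnorm : ‖(v : H)‖ ^ 2 = ‖a • (u : H)‖ ^ 2 + ‖b • (u' : H)‖ ^ 2 := by
    rw [hvc, norm_sub_sq (𝕜 := ℂ), z1, map_zero, mul_zero, sub_zero]
  have hHv : (inner ℂ (v : H) (A v)).re =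
      E * ‖a • (u : H)‖ ^ 2 + E' * ‖b • (u' : H)‖ ^ 2 := by
    have e1 : A v = (E : ℂ) • (a • (u : H)) - (E' : ℂ) • (b • (u' : H)) := by
      rw [hv, map_sub, map_smul, map_smul, hu, hu', smul_comm a, smul_comm b]
    rw [e1, hvc, inner_sub_left, inner_sub_right, inner_sub_right, Complex.sub_re, Complex.sub_re,
      Complex.sub_re, re_inner_smul_eigenvector (u := a • (u : H)) rfl,
      re_inner_smul_eigenvector (u := b • (u' : H)) rfl, inner_smul_right _ _ (E : ℂ),
      inner_smul_right _ _ (E' : ℂ), z1, z2, mul_zero, mul_zero, Complex.zero_re]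
    ring
  have hv0 : v = 0 := by
    refine eq_zero_of_inner_eq_zero hA (E := max E E') (max_lt hE hE') ?_ ?_
    · rw [hHv, hnorm, mul_add]
      gcongr
      · exact le_max_left _ _
      · exact le_max_right _ _
    · rw [hvc, inner_sub_right, inner_smul_right, inner_smul_right, ← ha, ← hb, mul_comm, sub_self]
  have h0 : b • (u' : H) = 0 := by
    have h1 : ‖(v : H)‖ ^ 2 = 0 := by rw [hv0]; simp
    rw [hnorm] at h1
    have h2 : ‖b • (u' : H)‖ ^ 2 = 0 := by
      nlinarith [sq_nonneg ‖a • (u : H)‖, sq_nonneg ‖b • (u' : H)‖]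
    simpa using h2
  rcases smul_eq_zero.1 h0 with h | h
  · exact hb0 h
  · exact hu0' (by exact_mod_cast h)

end Abstract

/-! ### Exactly one negative eigenvalue for a Schrödinger operator -/

theorem mem_schrodinger_domain (hV : Continuous V) (hC : ∀ x, |V x| ≤ C) (u : H2 n) :
    (u : L2 n) ∈ (schrodinger c V).domain :=
  ⟨u.2, mem_mulDomain hV hC _⟩

theorem mem_eigenspace_schrodinger (hV : Continuous V) (hC : ∀ x, |V x| ≤ C)
    (u : (schrodinger c V).domain) (E : ℝ) : u ∈ eigenspace (schrodinger c V) (E : ℂ) ↔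
      hamiltonian c hV hC ⟨u, u.2.1⟩ = (E : ℂ) • (u : L2 n) := by
  rw [eigenspace, LinearMap.mem_ker, LinearMap.sub_apply, sub_eq_zero]
  rfl

/-- A Schrödinger operator with bounded continuous potential whose form takes negative values, but
is nonnegative up to a form of rank one, has exactly one negative eigenvalue, which is simple. -/
theorem schrodinger_exists_unique_negative_eigenvalue (hV : Continuous V) (hC : ∀ x, |V x| ≤ C)
    (hF : MemLp F 2) (hκ : 0 ≤ κ)
    (hQ : ∀ u : bddH1 n, -κ * (∫ x, F x * u.1 x) ^ 2 ≤ energyForm c hV hC u u)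
    {u₀ : bddH1 n} (hu₀ : energyForm c hV hC u₀ u₀ < 0) :
    ∃ E : ℝ, E < 0 ∧ Module.finrank ℂ (eigenspace (schrodinger c V) (E : ℂ)) = 1 ∧
      ∀ E' : ℝ, E' < 0 → eigenspace (schrodinger c V) (E' : ℂ) ≠ ⊥ → E' = E := by
  obtain ⟨E, hE, ψ, hψ0, hψ⟩ := exists_weak_eigenfunction hV hC hF hκ hQ hu₀
  have hA := re_inner_hamiltonian_ge hV hC hF hQ
  set p : H2 n := ⟨ψ, memSobolev_two_of_laplacian hψ⟩ with hp
  have hpE : hamiltonian c hV hC p = (E : ℂ) • (p : L2 n) := by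
    rw [hamiltonian_apply, hp, laplacianH2_eq_of_laplacian hψ]
    push_cast
    module
  have hp0 : p ≠ 0 := fun h => hψ0 (by simpa [hp] using congrArg (Subtype.val) h)
  refine ⟨E, hE, ?_, fun E' hE' hne => ?_⟩
  · have hmem := (mem_eigenspace_schrodinger hV hC
      ⟨ψ, mem_schrodinger_domain (c := c) hV hC p⟩ E).2 hpE
    have he0 : (⟨_, hmem⟩ : eigenspace (schrodinger c V) (E : ℂ)) ≠ 0 := fun h =>
      hψ0 (congrArg (fun z => (z.1 : L2 n)) h)
    generalize (⟨_, hmem⟩ : eigenspace (schrodinger c V) (E : ℂ)) = e at he0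
    obtain ⟨ℓ, hℓ⟩ : ∃ ℓ : eigenspace (schrodinger c V) (E : ℂ) →ₗ[ℂ] ℂ,
        ∀ z, ℓ z = inner ℂ (realL2 hF) ((z : (schrodinger c V).domain) : L2 n) :=
      ⟨(innerSL ℂ (realL2 hF) : L2 n →ₗ[ℂ] ℂ) ∘ₗ (schrodinger c V).domain.subtype ∘ₗ
        (eigenspace (schrodinger c V) (E : ℂ)).subtype, fun _ => rfl⟩
    -- Pairing with `F` is injective on the eigenspace, so the eigenspace is at most
    -- one-dimensional.
    have hker : ∀ z, ℓ z = 0 → z = 0 := fun z hz => by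
      have h1 := (mem_eigenspace_schrodinger hV hC z.1 E).1 z.2
      rw [hℓ] at hz
      have h2 := eq_zero_of_inner_eq_zero hA hE (u := ⟨z.1, z.1.2.1⟩)
        (re_inner_smul_eigenvector h1).le hz
      have h3 : ((z : (schrodinger c V).domain) : L2 n) = 0 :=
        congrArg (fun q : H2 n => (q : L2 n)) h2
      exact Subtype.ext (Subtype.ext h3)
    refine finrank_eq_one e he0 fun z => ?_
    have hℓe : ℓ e ≠ 0 := fun h => he0 (hker e h)
    refine ⟨ℓ z / ℓ e, ?_⟩
    rw [← sub_eq_zero]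
    refine hker _ ?_
    rw [map_sub, map_smul, smul_eq_mul, div_mul_cancel₀ _ hℓe, sub_self]
  · obtain ⟨z, hz, hz0⟩ := Submodule.exists_mem_ne_zero_of_ne_bot hne
    refine eigenvalue_unique (inner_hamiltonian (c := c) hV hC) hA hE hE' hp0
      (u' := ⟨z, z.2.1⟩) (fun h => hz0 ?_) hpE ((mem_eigenspace_schrodinger hV hC z E').1 hz)
    have h3 : (z : L2 n) = 0 := congrArg (fun q : H2 n => (q : L2 n)) h
    exact Subtype.ext h3

/-! ### The nonlinearity `β(s²) s` -/

section Nonlinearity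

variable {β : ℝ → ℝ}

theorem isPotential_G (hβ : ContDiff ℝ 1 fun s : ℝ => β (s ^ 2) * s) (α : ℝ) :
    IsPotential (G β α) (fun s => β (s ^ 2) * s - α ^ 2 / 2 * s)
      (fun s => deriv (fun s : ℝ => β (s ^ 2) * s) s - α ^ 2 / 2) where
  hasDerivAt s := by
    have h : Continuous fun s : ℝ => β (s ^ 2) * s - α ^ 2 / 2 * s :=
      hβ.continuous.sub (continuous_const.mul continuous_id)
    exact intervalIntegral.integral_hasDerivAt_right (h.intervalIntegrable _ _)
      h.stronglyMeasurable.stronglyMeasurableAtFilter h.continuousAt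
  hasDerivAt' s := by
    have h := ((hβ.differentiable one_ne_zero) s).hasDerivAt.sub
      ((hasDerivAt_id s).const_mul (α ^ 2 / 2))
    rw [mul_one] at h
    exact h
  continuous' := (hβ.continuous_deriv le_rfl).sub continuous_const
  zero := intervalIntegral.integral_same
  zero' := by simp

/-- Smoothness is assumed only for `s ↦ β(s²)s`; away from the origin `β` is recovered from it by
the substitution `s = √t` and a division. Positivity of the ground state makes this enough. -/
theorem deriv_nonlinearity (hβ : ContDiff ℝ 1 fun s : ℝ => β (s ^ 2) * s) {s : ℝ} (hs : 0 < s) :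
    deriv (fun s : ℝ => β (s ^ 2) * s) s = β (s ^ 2) + 2 * deriv β (s ^ 2) * s ^ 2 := by
  have h1 : DifferentiableAt ℝ β (s ^ 2) := by
    have h2 : DifferentiableAt ℝ (fun t : ℝ => (β (√t ^ 2) * √t) / √t) (s ^ 2) := by
      have h3 : DifferentiableAt ℝ (fun t : ℝ => √t) (s ^ 2) :=
        (Real.hasDerivAt_sqrt (by positivity)).differentiableAt
      have h4 : DifferentiableAt ℝ (fun t : ℝ => β (√t ^ 2) * √t) (s ^ 2) :=
        DifferentiableAt.comp (s ^ 2) (f := fun t : ℝ => √t)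
          ((hβ.differentiable one_ne_zero) _) h3
      exact h4.div h3 (by positivity)
    refine h2.congr_of_eventuallyEq ?_
    filter_upwards [lt_mem_nhds (show 0 < s ^ 2 by positivity)] with t ht
    rw [mul_div_cancel_right₀ _ (Real.sqrt_pos.2 ht).ne', Real.sq_sqrt ht.le]
  have h2 : HasDerivAt (fun s : ℝ => β (s ^ 2)) (deriv β (s ^ 2) * (2 * s)) s := by
    have h3 : HasDerivAt (fun s : ℝ => s ^ 2) (2 * s) s := by simpa using hasDerivAt_pow 2 s
    exact HasDerivAt.comp s (h₂ := β) (h := fun s : ℝ => s ^ 2) h1.hasDerivAt h3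
  have h3 : HasDerivAt (fun s : ℝ => β (s ^ 2) * s)
      (deriv β (s ^ 2) * (2 * s) * s + β (s ^ 2) * 1) s := h2.mul (hasDerivAt_id s)
  rw [h3.deriv]
  ring

end Nonlinearity

/-! ### Conclusion for the ground state -/

/-- A ground state constructed from the variational problem minimizes the scale-invariant quotient
and solves the equation with multiplier one. -/
theorem IsVariationalGroundState.isQuotientMin {n : ℕ} (hn : 3 ≤ n) {β : ℝ → ℝ} {α θ : ℝ}
    (hθ : θ * n = n - 2) (hβ : ContDiff ℝ 1 fun s : ℝ => β (s ^ 2) * s) {φ : Rn n → ℝ}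
    (hφ : IsVariationalGroundState β α φ) :
    IsQuotientMin (G β α) θ φ ∧ ContDiff ℝ 2 φ ∧ (∀ x, 0 < φ x) ∧
      (∀ x, Δ φ x = -2 * (β (φ x ^ 2) * φ x - α ^ 2 / 2 * φ x)) ∧
      4 = dirichlet φ * θ / ∫ x, G β α (φ x) := by
  obtain ⟨w, lam, hmin, hC, hpos, hrad, hEL, hφw⟩ := hφ
  have hg := isPotential_G hβ α
  have hnt : Nontrivial (Rn n) := by
    have : Nonempty (Fin n) := ⟨⟨0, by omega⟩⟩
    infer_instance
  have hn' : (3 : ℝ) ≤ n := by exact_mod_cast hn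
  have hθ0 : 0 < θ := by
    by_contra h
    nlinarith
  have hw := hmin.isQuotientMin (by omega) hθ hg (hC.of_le one_le_two) hrad
  -- The sign comes from `4 lam = θ ∫|∇w|² / W[w]`, where all factors on the right are positive.
  have hlam : 0 < lam := by
    have h1 := hw.multiplier hg hC hEL
    have h2 := div_pos (mul_pos (hw.dirichlet_pos hg) hθ0) hw.pos
    linarith
  have ht : 0 < lam ^ (-(1 / 2) : ℝ) := Real.rpow_pos_of_pos hlam _
  have ht2 : (lam ^ (-(1 / 2) : ℝ)) ^ 2 * lam = 1 := by
    rw [← Real.rpow_natCast, ← Real.rpow_mul hlam.le]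
    norm_num
    rw [Real.rpow_neg_one, inv_mul_cancel₀ hlam.ne']
  generalize lam ^ (-(1 / 2) : ℝ) = t at hφw ht ht2
  obtain rfl : φ = fun x => w (t • x) := funext hφw
  have hq := hw.comp_smul hθ ht
  have hC2 : ContDiff ℝ 2 fun x => w (t • x) := hC.comp (contDiff_const_smul t)
  have heq : ∀ x, Δ (fun x => w (t • x)) x =
      -2 * (β (w (t • x) ^ 2) * w (t • x) - α ^ 2 / 2 * w (t • x)) := fun x => by
    rw [laplacian_comp_smul hC]
    linear_combination (-2 * t ^ 2) * hEL (t • x) -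
      2 * (β (w (t • x) ^ 2) * w (t • x) - α ^ 2 / 2 * w (t • x)) * ht2
  refine ⟨hq, hC2, fun x => hpos _, heq, ?_⟩
  have h1 := hq.multiplier hg hC2 (lam := 1) fun x => by rw [heq x]; ring
  linarith

theorem energyForm_self {n : ℕ} {V : Rn n → ℝ} {c C : ℝ} (hV : Continuous V)
    (hC : ∀ x, |V x| ≤ C) (u : bddH1 n) :
    energyForm c hV hC u u = dirichlet u.1 / 2 - ∫ x, (V x - c) * u.1 x ^ 2 := by
  have i1 : Integrable fun x => u.1 x * u.1 x := u.2.memLp.integrable_mul u.2.memLp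
  have i2 : Integrable fun x => V x * u.1 x * u.1 x :=
    (memLp_mul_of_bounded hV hC u.2.memLp).integrable_mul u.2.memLp
  have e1 : ∀ x, (V x - c) * u.1 x ^ 2 = V x * u.1 x * u.1 x - c * (u.1 x * u.1 x) :=
    fun x => by ring
  rw [energyForm_apply, dirichlet]
  simp only [e1, real_inner_self_eq_norm_sq]
  rw [integral_sub i2 (i1.const_mul _), integral_const_mul]
  ring

/-- The linearization at a minimizer of the scale-invariant quotient has exactly one negative
eigenvalue, which is simple. -/
theorem IsQuotientMin.exists_unique_negative_eigenvalue {n : ℕ} (hn : 1 ≤ n) {g f f' : ℝ → ℝ}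
    {θ c : ℝ} (hθ : θ ≤ 1) (hg : IsPotential g f f') {φ : Rn n → ℝ} (hq : IsQuotientMin g θ φ)
    (hC2 : ContDiff ℝ 2 φ) (heq : ∀ x, Δ φ x = -2 * f (φ x))
    (hμ : 4 = dirichlet φ * θ / ∫ x, g (φ x)) {V : Rn n → ℝ} (hVf : ∀ x, V x - c = f' (φ x)) :
    ∃ E : ℝ, E < 0 ∧ Module.finrank ℂ (eigenspace (schrodinger c V) (E : ℂ)) = 1 ∧
      ∀ E' : ℝ, E' < 0 → eigenspace (schrodinger c V) (E' : ℂ) ≠ ⊥ → E' = E := by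
  have hV : Continuous V := by
    have h1 : V = fun x => f' (φ x) + c := funext fun x => by rw [← hVf, sub_add_cancel]
    rw [h1]
    exact (hg.continuous'.comp hC2.continuous).add continuous_const
  obtain ⟨M, hM⟩ := hq.isBddH1.bounded
  obtain ⟨K, -, hK⟩ := hg.exists_bound M
  have hC : ∀ x, |V x| ≤ K + |c| := fun x => by
    have h1 := (hK _ (hM x)).1
    have h2 := abs_add_le (V x - c) c
    rw [sub_add_cancel, hVf] at h2
    linarith
  obtain ⟨ψ, hψ, hψneg⟩ := exists_negative_direction hn hg hC2 hq.isBddH1 hq.pos heq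
  refine schrodinger_exists_unique_negative_eigenvalue hV hC (hg.memLp_deriv_comp hq.isBddH1)
    -- With `μ = 4` the second variation inequality, divided by two, gives exactly this constant.
    (κ := (1 - θ) / ∫ x, g (φ x)) (div_nonneg (sub_nonneg.2 hθ) hq.pos.le) (fun u => ?_)
    (u₀ := ⟨ψ, hψ⟩) ?_
  · rw [energyForm_self]
    simp only [hVf]
    have h1 := (hq.variation hg u.2 hμ).2
    have h2 : 4 * (θ - 1) / (2 * ∫ x, g (φ x)) = 2 * -((1 - θ) / ∫ x, g (φ x)) := by
      have := hq.pos.ne'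
      field_simp
      ring
    rw [h2] at h1
    linarith
  · rw [energyForm_self]
    simp only [hVf]
    exact hψneg

end NLS

end

theorem mainTheorem5 (n : ℕ) (hn : 3 ≤ n) (β : ℝ → ℝ) (α p C : ℝ) (hα : α ≠ 0)
    (hβ : ContDiff ℝ 1 (fun s : ℝ => β (s ^ 2) * s))
    (hp : 1 < p) (hp' : p < 1 + 4 / ((n : ℝ) - 2))
    (hgrowth : ∀ s : ℝ, |β (s ^ 2)| ≤ C * |s| ^ (p - 1))
    (hG : ∃ s₀ : ℝ, 0 < NLS.G β α s₀)
    (hmono : ∀ s : ℝ, 0 ≤ s → 2 * (∫ τ in (0 : ℝ)..s, β (τ ^ 2) * τ) ≤ β (s ^ 2) * s ^ 2)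
    (φ : NLS.Rn n → ℝ) (hφ : NLS.IsVariationalGroundState β α φ) :
    ∃ E : ℝ, E < 0 ∧
      Module.finrank ℂ (NLS.eigenspace (NLS.Lplus β α φ) (E : ℂ)) = 1 ∧
      ∀ E' : ℝ, E' < 0 → NLS.eigenspace (NLS.Lplus β α φ) (E' : ℂ) ≠ ⊥ → E' = E := by
  have hn' : (3 : ℝ) ≤ n := by exact_mod_cast hn
  obtain ⟨θ, hθ⟩ : ∃ θ : ℝ, θ * n = n - 2 := ⟨(n - 2) / n, div_mul_cancel₀ _ (by positivity)⟩
  have hθ1 : θ ≤ 1 := by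
    by_contra h
    nlinarith
  obtain ⟨hq, hC2, hpos, heq, hμ⟩ := hφ.isQuotientMin hn hθ hβ
  exact hq.exists_unique_negative_eigenvalue (by omega) hθ1 (NLS.isPotential_G hβ α) hC2 heq hμ
    fun x => by rw [NLS.deriv_nonlinearity hβ (hpos x)]
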